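/- Setting. Let $\mathcal X=\{x\in\mathbb R^d: Ax\le b\}$ be a bounded polytope with diameter $D$ (Euclidean norm) and vertex set $\mathcal V$. Let $L\in\mathbb R$, $\mu>0$, $M\in\mathbb R$, and let $\varepsilon_g>0$ satisfy $4D\varepsilon_g<1$. Consider objective functions $f$ on $\mathcal X$ with $|f|\le M$ on $\mathcal X$ whose gradient satisfies, for all $x,y\in\mathcal X$, $$\|\nabla f(x)-\nabla f(y)\|\le L\|x-y\|,\qquad f(y)\ge f(x)+\nabla f(x)^T(y-x)+\tfrac{\mu}{2}\|x-y\|^2 .$$ (It suffices that $f$ is differentiable relative to $\mathcal X$ at the points of $\mathcal X$.) Put $f^*=\min_{x\in\mathcal X}f(x)$. For $\varepsilon>0$ and random iterates $X_0,X_1,\dots$ put $T_\varepsilon=\inf\{k\ge0: f(X_k)-f^*\le\varepsilon\}\in\{0,1,\dots\}\cup\{\infty\}$. Both algorithms run up to time $T_\varepsilon$, after which their state is kept constant; $G_k$ denotes a random estimate of $\nabla f(X_k)$, and $S_k\in\mathcal V$ minimizes $G_k^Ts$ over $s\in\mathcal X$. Standard Frank--Wolfe. $X_0=x_0\in\mathcal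 X$ is deterministic, and for $k<T_\varepsilon$, $X_{k+1}=X_k+\gamma(S_k-X_k)$ with $\gamma=\min\{1,\varepsilon/(2LD^2)\}$. Let $(\mathcal F_k)$ be a filtration such that $X_k$ is $\mathcal F_k$-measurable and $G_k,S_k$ are $\mathcal F_{k+1}$-measurable. The estimates are good with probability at least $p$ if for all $k$, almost surely on $\{k<T_\varepsilon\}$, $$\mathbb P\big(\|G_k-\nabla f(X_k)\|\le \varepsilon/(4D)\,\big|\,\mathcal F_k\big)\ge p .$$ Away-step Frank--Wolfe. $X_0=x_0=\sum_{u\in\mathcal V}\alpha^{(0)}_u u$ is deterministic, with deterministic weights $\alpha^{(0)}_u\ge0$ summing to $1$. Let $U_k=\{u\in\mathcal V:\alpha^{(k)}_u>0\}$. For $k<T_\varepsilon$, let $V_k\in U_k$ maximize $G_k^Tu$ over $u\in U_k$. If $-G_k^T(S_k-X_k)\ge -G_k^T(X_k-V_k)$ (normal step), let $d_k=S_k-X_k$ and $\gamma_k^{\max}=1$; otherwise (away step), let $d_k=X_k-V_k$ and $\gamma_k^{\max}=\alpha^{(k)}_{V_k}/(1-\alpha^{(k)}_{V_k})$. Set $$\gamma_k=\min\Big\{\gamma_k^{\max},\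 \frac{-G_k^Td_k}{L\|d_k\|^2}\Big\},\qquad X_{k+1}=X_k+\gamma_kd_k$$ (with $0/0=0$). The weights become $(1-\gamma_k)\alpha^{(k)}$ with $\gamma_k$ added at $S_k$ after a normal step, and $(1+\gamma_k)\alpha^{(k)}$ with $\gamma_k$ subtracted at $V_k$ after an away step. Let $(\mathcal F_k)$ be a filtration such that $X_k$ is $\mathcal F_k$-measurable and $G_k,S_k,V_k$ are $\mathcal F_{k+1}$-measurable. The estimates are good with probability at least $p$ if for all $k$, almost surely on $\{k<T_\varepsilon\}$, $$\mathbb P\big(\|G_k-\nabla f(X_k)\|\le \varepsilon_g\,G_k^T(V_k-S_k)\,\big|\,\mathcal F_k\big)\ge p .$$ Theorem. For each of the two algorithms there is a constant $C>0$, depending only on $A,b,L,\mu,M,\varepsilon_g$ (not on $\varepsilon$), such that for every $\varepsilon>0$ there are $p_g\in(0,1)$ and $\delta>0$ with the following property. For every such $f$, every deterministic start $x_0$ (with any initial weights, in the away-step case) with $f(x_0)-f^*>\varepsilon$, and every run of the algorithm, on any probability space, whose gradient estimates are good with probability at least $p_g$: 1. $\mathbb E[T_\varepsilon]\le C\,\varepsilon^{-2}\,(f(x_0)-f^*)$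 for standard Frank--Wolfe, and $\mathbb E[T_\varepsilon]\le C\,\varepsilon^{-1}\,(f(x_0)-f^*)$ for away-step Frank--Wolfe; 2. $T_\varepsilon<\infty$ almost surely, and $\mathbb E[e^{tT_\varepsilon}]<\infty$ for all $|t|\le\delta$, i.e. the moment generating function of $T_\varepsilon$ is finite in a neighborhood of $0$. -/

import Mathlib

open MeasureTheory

noncomputable section

namespace StochFW

/-- The feasible region `{x : A x ≤ b}` in Euclidean space. -/
def polytope {d m : ℕ} (A : Matrix (Fin m) (Fin d) ℝ) (b : Fin m → ℝ) :
    Set (EuclideanSpace ℝ (Fin d)) :=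
  {x | ∀ i, (A.mulVec (WithLp.ofLp x)) i ≤ b i}

/-- The standing assumptions on the objective `f` over the feasible set `X`. The field `f'` is
the gradient of `f` on `X`; at boundary points, differentiability relative to `X` is enough. -/
structure IsObjective {d : ℕ} (X : Set (EuclideanSpace ℝ (Fin d))) (L μ : ℝ)
    (f : EuclideanSpace ℝ (Fin d) → ℝ)
    (f' : EuclideanSpace ℝ (Fin d) → EuclideanSpace ℝ (Fin d)) : Prop where
  hasGradient : ∀ x ∈ X, HasGradientWithinAt f (f' x) X x
  lipschitz : ∀ x ∈ X, ∀ y ∈ X, ‖f' x - f' y‖ ≤ L * ‖x - y‖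
  stronglyConvex : ∀ x ∈ X, ∀ y ∈ X,
    f x + inner ℝ (f' x) (y - x) + μ / 2 * ‖x - y‖ ^ 2 ≤ f y

/-- The optimal value `f* = min_{x ∈ X} f x`. -/
def optVal {d : ℕ} (X : Set (EuclideanSpace ℝ (Fin d))) (f : EuclideanSpace ℝ (Fin d) → ℝ) : ℝ :=
  sInf (f '' X)

/-- The time `T_ε = inf {k : f (x k) - f* ≤ ε}`, equal to `⊤` if there is no such `k`. -/
def hitTime {d : ℕ} (X : Set (EuclideanSpace ℝ (Fin d))) (f : EuclideanSpace ℝ (Fin d) → ℝ)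
    (ε : ℝ) (x : ℕ → EuclideanSpace ℝ (Fin d)) : ℕ∞ :=
  ⨅ (k : ℕ) (_ : f (x k) - optVal X f ≤ ε), (k : ℕ∞)

/-- `s` is a vertex of `X` that solves the linear program `min_{y ∈ X} gᵀ y`. -/
def IsLPVertex {d : ℕ} (X : Set (EuclideanSpace ℝ (Fin d))) (g s : EuclideanSpace ℝ (Fin d)) :
    Prop :=
  s ∈ X.extremePoints ℝ ∧ ∀ y ∈ X, inner ℝ g s ≤ inner ℝ g y

/-- The weights `α` represent `x` as a convex combination of vertices of `X`. The active vertex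
set is `α.support`. -/
def IsVertexRep {d : ℕ} (X : Set (EuclideanSpace ℝ (Fin d)))
    (α : EuclideanSpace ℝ (Fin d) →₀ ℝ) (x : EuclideanSpace ℝ (Fin d)) : Prop :=
  (∀ u, 0 ≤ α u) ∧ (↑α.support ⊆ X.extremePoints ℝ) ∧
    (α.sum fun _ a => a) = 1 ∧ (α.sum fun u a => a • u) = x

/-- `v` maximizes `gᵀ u` over the active vertices `u`. -/
def IsAwayVertex {d : ℕ} (α : EuclideanSpace ℝ (Fin d) →₀ ℝ) (g v : EuclideanSpace ℝ (Fin d)) :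
    Prop :=
  v ∈ α.support ∧ ∀ u ∈ α.support, inner ℝ g u ≤ inner ℝ g v

/-! ### The standard Frank-Wolfe algorithm -/

/-- Step size of the standard algorithm, `min {1, ε / (2 L D²)}`, `D` the diameter of `X`. -/
def fwStepSize {d : ℕ} (X : Set (EuclideanSpace ℝ (Fin d))) (L ε : ℝ) : ℝ :=
  min 1 (ε / (2 * L * Metric.diam X ^ 2))

/-- A trajectory of the standard Frank-Wolfe algorithm (iterates `x`, gradient estimates `g`,
LP vertices `s`), run up to `T_ε` and constant afterwards. -/
structure IsFWPath {d : ℕ} (X : Set (EuclideanSpace ℝ (Fin d)))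
    (f : EuclideanSpace ℝ (Fin d) → ℝ) (L ε : ℝ)
    (x g s : ℕ → EuclideanSpace ℝ (Fin d)) : Prop where
  lp : ∀ k : ℕ, (k : ℕ∞) < hitTime X f ε x → IsLPVertex X (g k) (s k)
  step : ∀ k : ℕ, (k : ℕ∞) < hitTime X f ε x →
    x (k + 1) = x k + fwStepSize X L ε • (s k - x k)
  frozen : ∀ k : ℕ, hitTime X f ε x ≤ (k : ℕ∞) → x (k + 1) = x k

/-- The stochastic process generated by the standard Frank-Wolfe algorithm from the deterministic
point `x₀`. The `σ`-algebra `ℱ k` contains the history `(G i, S i)` for `i < k` and `(X i)` for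
`i ≤ k`. -/
structure IsFWProcess {d : ℕ} {Ω : Type*} {m₀ : MeasurableSpace Ω} (ℱ : Filtration ℕ m₀)
    (K : Set (EuclideanSpace ℝ (Fin d))) (f : EuclideanSpace ℝ (Fin d) → ℝ) (L ε : ℝ)
    (x₀ : EuclideanSpace ℝ (Fin d)) (X G S : ℕ → Ω → EuclideanSpace ℝ (Fin d)) : Prop where
  mem_init : x₀ ∈ K
  init : ∀ ω, X 0 ω = x₀
  path : ∀ ω, IsFWPath K f L ε (fun k => X k ω) (fun k => G k ω) (fun k => S k ω)
  measurable_iterate : ∀ k, Measurable[ℱ k] (X k)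
  measurable_gradient : ∀ k, Measurable[ℱ (k + 1)] (G k)
  measurable_vertex : ∀ k, Measurable[ℱ (k + 1)] (S k)

/-- At every iteration `k`, on the event `k < T_ε`, the conditional probability given `ℱ k` of
`‖G k - ∇f (X k)‖ ≤ ε / (4 D)` is at least `p`. -/
def GoodFW {d : ℕ} {Ω : Type*} {m₀ : MeasurableSpace Ω} (P : Measure Ω) (ℱ : Filtration ℕ m₀)
    (K : Set (EuclideanSpace ℝ (Fin d))) (f : EuclideanSpace ℝ (Fin d) → ℝ)
    (f' : EuclideanSpace ℝ (Fin d) → EuclideanSpace ℝ (Fin d)) (ε p : ℝ)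
    (X G : ℕ → Ω → EuclideanSpace ℝ (Fin d)) : Prop :=
  ∀ k : ℕ, ∀ᵐ ω ∂P, (k : ℕ∞) < hitTime K f ε (fun j => X j ω) →
    p ≤ (P[Set.indicator {ω' | ‖G k ω' - f' (X k ω')‖ ≤ ε / (4 * Metric.diam K)}
      (fun _ => (1 : ℝ)) | ℱ k]) ω

/-! ### The away-step Frank-Wolfe algorithm -/

/-- The test `-gᵀ (s - x) ≥ -gᵀ (x - v)` that selects a normal Frank-Wolfe step. -/
def ChoosesFW {d : ℕ} (x g s v : EuclideanSpace ℝ (Fin d)) : Prop :=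
  -(inner ℝ g (s - x)) ≥ -(inner ℝ g (x - v))

open scoped Classical in
/-- The search direction. -/
def awayDir {d : ℕ} (x g s v : EuclideanSpace ℝ (Fin d)) : EuclideanSpace ℝ (Fin d) :=
  if ChoosesFW x g s v then s - x else x - v

open scoped Classical in
/-- The maximal step size: `1` for a normal step, `α_v / (1 - α_v)` for an away step. -/
def awayMaxStep {d : ℕ} (α : EuclideanSpace ℝ (Fin d) →₀ ℝ) (x g s v : EuclideanSpace ℝ (Fin d)) :
    ℝ :=
  if ChoosesFW x g s v then 1 else α v / (1 - α v)

/-- The step size `min {γ_max, -gᵀ d / (L ‖d‖²)}` in direction `d`. -/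
def awayStepSize {d : ℕ} (L : ℝ) (α : EuclideanSpace ℝ (Fin d) →₀ ℝ)
    (x g s v : EuclideanSpace ℝ (Fin d)) : ℝ :=
  min (awayMaxStep α x g s v)
    (-(inner ℝ g (awayDir x g s v)) / (L * ‖awayDir x g s v‖ ^ 2))

open scoped Classical in
/-- The new weights: `(1 - γ) α` with `γ` added at `s` after a normal step, and `(1 + γ) α` with
`γ` subtracted at `v` after an away step. -/
def awayWeights {d : ℕ} (L : ℝ) (α : EuclideanSpace ℝ (Fin d) →₀ ℝ)
    (x g s v : EuclideanSpace ℝ (Fin d)) : EuclideanSpace ℝ (Fin d) →₀ ℝ :=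
  if ChoosesFW x g s v then
    (1 - awayStepSize L α x g s v) • α + Finsupp.single s (awayStepSize L α x g s v)
  else
    (1 + awayStepSize L α x g s v) • α - Finsupp.single v (awayStepSize L α x g s v)

/-- A trajectory of the away-step Frank-Wolfe algorithm (iterates `x`, weights `α`, gradient
estimates `g`, LP vertices `s`, away vertices `v`), run up to `T_ε` and constant afterwards. -/
structure IsAwayPath {d : ℕ} (X : Set (EuclideanSpace ℝ (Fin d)))
    (f : EuclideanSpace ℝ (Fin d) → ℝ) (L ε : ℝ)
    (x : ℕ → EuclideanSpace ℝ (Fin d)) (α : ℕ → EuclideanSpace ℝ (Fin d) →₀ ℝ)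
    (g s v : ℕ → EuclideanSpace ℝ (Fin d)) : Prop where
  lp : ∀ k : ℕ, (k : ℕ∞) < hitTime X f ε x → IsLPVertex X (g k) (s k)
  away : ∀ k : ℕ, (k : ℕ∞) < hitTime X f ε x → IsAwayVertex (α k) (g k) (v k)
  step : ∀ k : ℕ, (k : ℕ∞) < hitTime X f ε x →
    x (k + 1) = x k + awayStepSize L (α k) (x k) (g k) (s k) (v k) •
      awayDir (x k) (g k) (s k) (v k)
  weights : ∀ k : ℕ, (k : ℕ∞) < hitTime X f ε x →
    α (k + 1) = awayWeights L (α k) (x k) (g k) (s k) (v k)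
  frozen : ∀ k : ℕ, hitTime X f ε x ≤ (k : ℕ∞) → x (k + 1) = x k ∧ α (k + 1) = α k

/-- The stochastic process generated by the away-step Frank-Wolfe algorithm from the deterministic
point `x₀`, represented by the deterministic weights `α₀`. The `σ`-algebra `ℱ k` contains the
history `(G i, S i, V i)` for `i < k` and `(X i)` for `i ≤ k`, which determines the weights up to
iteration `k`. -/
structure IsAwayProcess {d : ℕ} {Ω : Type*} {m₀ : MeasurableSpace Ω} (ℱ : Filtration ℕ m₀)
    (K : Set (EuclideanSpace ℝ (Fin d))) (f : EuclideanSpace ℝ (Fin d) → ℝ) (L ε : ℝ)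
    (x₀ : EuclideanSpace ℝ (Fin d)) (α₀ : EuclideanSpace ℝ (Fin d) →₀ ℝ)
    (X : ℕ → Ω → EuclideanSpace ℝ (Fin d)) (α : ℕ → Ω → EuclideanSpace ℝ (Fin d) →₀ ℝ)
    (G S V : ℕ → Ω → EuclideanSpace ℝ (Fin d)) : Prop where
  rep_init : IsVertexRep K α₀ x₀
  init : ∀ ω, X 0 ω = x₀
  weights_init : ∀ ω, α 0 ω = α₀
  path : ∀ ω, IsAwayPath K f L ε (fun k => X k ω) (fun k => α k ω) (fun k => G k ω)
    (fun k => S k ω) (fun k => V k ω)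
  measurable_iterate : ∀ k, Measurable[ℱ k] (X k)
  measurable_gradient : ∀ k, Measurable[ℱ (k + 1)] (G k)
  measurable_vertex : ∀ k, Measurable[ℱ (k + 1)] (S k)
  measurable_away : ∀ k, Measurable[ℱ (k + 1)] (V k)

/-- At every iteration `k`, on the event `k < T_ε`, the conditional probability given `ℱ k` of
`‖G k - ∇f (X k)‖ ≤ ε_g (G k)ᵀ (V k - S k)` is at least `p`. -/
def GoodAway {d : ℕ} {Ω : Type*} {m₀ : MeasurableSpace Ω} (P : Measure Ω) (ℱ : Filtration ℕ m₀)
    (K : Set (EuclideanSpace ℝ (Fin d))) (f : EuclideanSpace ℝ (Fin d) → ℝ)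
    (f' : EuclideanSpace ℝ (Fin d) → EuclideanSpace ℝ (Fin d)) (ε εg p : ℝ)
    (X G S V : ℕ → Ω → EuclideanSpace ℝ (Fin d)) : Prop :=
  ∀ k : ℕ, ∀ᵐ ω ∂P, (k : ℕ∞) < hitTime K f ε (fun j => X j ω) →
    p ≤ (P[Set.indicator
      {ω' | ‖G k ω' - f' (X k ω')‖ ≤ εg * inner ℝ (G k ω') (V k ω' - S k ω')}
      (fun _ => (1 : ℝ)) | ℱ k]) ω

end StochFW

end

/-! Both parts reduce to one pathwise inequality. Along every trajectory a nonnegative potential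
falls by at least `θ` at each step before `T_ε` whose gradient estimate is good, and rises by at
most `(K - 1) θ` at a bad one. Hence the number of steps before `T_ε` is at most `a + K * (number of
bad steps)`, with `a` the initial potential divided by `θ`. Let a bad step have conditional
probability at most `2 ^ (-(K + 1))`. Taking expectations, the bad steps cost at most half of the
expected number of steps, so `E[T] ≤ 2 a`. For the tail, the weight `2 ^ (K * bad)` on `{n < T}` has
expectation at most `(3/2) ^ n`, while on that event it is at least `2 ^ (n - ⌈a⌉)`; hence `P(n <
T)` decays like `(3/4) ^ n`, and `δ = log (5/4)` always works (`hitting_time_bounds`).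

For standard Frank-Wolfe the potential is `f - f*`. The descent lemma gives a decrease of `γ ε / 2`
with `γ` the step size, of order `ε²` (`IsObjective.fw_step_le`).

For the away-step variant, write `G = gᵀ (v - s)` for the pairwise gap. A geometric estimate on the
polytope (`exists_pairwise_gap_constant`) bounds `gᵀ (x - y)` by `c ‖x - y‖ G`; with strong
convexity, `G²` dominates the optimality gap (`IsObjective.gap_le_sq`), so a good step not cut short
by the boundary gains order `ε`. An away step of maximal length may gain almost nothing, but it
removes an active vertex, and any other step adds at most one. The potential is therefore `f - f*`
plus `θ` times the number of active vertices (`IsObjective.away_potential_le`). -/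

noncomputable section

namespace StochFW

/-! ### Hitting times controlled by the number of bad steps. -/

section HittingTime

variable {Ω : Type*} {m₀ : MeasurableSpace Ω} {P : Measure Ω} [IsProbabilityMeasure P]

/-- If the event `E` has conditional probability at least `p` on `A`, its complement has weight at
most `1 - p` against nonnegative functions that are measurable and supported in `A`. -/
theorem integral_mul_indicator_compl_le {m : MeasurableSpace Ω} (hm : m ≤ m₀) {A E : Set Ω}
    (hE : MeasurableSet[m₀] E) {p : ℝ}
    (hp : ∀ᵐ ω ∂P, ω ∈ A → p ≤ (P[E.indicator (fun _ => (1 : ℝ)) | m]) ω)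
    {Y : Ω → ℝ} (hY : StronglyMeasurable[m] Y) (hY0 : ∀ ω, 0 ≤ Y ω)
    (hYA : ∀ ω, ω ∉ A → Y ω = 0) (hYint : Integrable Y P) :
    ∫ ω, Y ω * Eᶜ.indicator (fun _ => (1 : ℝ)) ω ∂P ≤ (1 - p) * ∫ ω, Y ω ∂P := by
  set I : Ω → ℝ := E.indicator (fun _ => (1 : ℝ)) with hI
  have hIint : Integrable I P := (integrable_const (1 : ℝ)).indicator hE
  have hI1 : ∀ ω, ‖I ω‖ ≤ 1 := fun ω => by
    by_cases h : ω ∈ E <;> simp [hI, h]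
  have hYI : Integrable (Y * I) P :=
    hYint.mul_bdd (c := 1) hIint.aestronglyMeasurable (Filter.Eventually.of_forall hI1)
  -- `Y` is known given `m`, so it can be pulled out and the conditional bound integrated against
  -- it.
  have hpull : P[Y * I | m] =ᵐ[P] Y * P[I | m] :=
    condExp_mul_of_stronglyMeasurable_left hY hYI hIint
  have h1 : ∫ ω, Y ω * I ω ∂P = ∫ ω, Y ω * (P[I | m]) ω ∂P := by
    have := integral_condExp (μ := P) (f := Y * I) hm
    rw [integral_congr_ae hpull] at this
    exact this.symm
  have hYc : Integrable (fun ω => Y ω * (P[I | m]) ω) P :=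
    (integrable_condExp (m := m) (μ := P) (f := Y * I)).congr hpull
  have h2 : ∫ ω, p * Y ω ∂P ≤ ∫ ω, Y ω * (P[I | m]) ω ∂P := by
    refine integral_mono_ae (hYint.const_mul p) hYc ?_
    filter_upwards [hp] with ω hω
    by_cases hA : ω ∈ A
    · nlinarith [hY0 ω, hω hA]
    · simp [hYA ω hA]
  have h3 : ∀ ω, Y ω * Eᶜ.indicator (fun _ => (1 : ℝ)) ω = Y ω - Y ω * I ω := fun ω => by
    by_cases h : ω ∈ E <;> simp [hI, h]
  simp_rw [h3]
  rw [integral_sub hYint (show Integrable (fun ω => Y ω * I ω) P from hYI), h1]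
  rw [integral_const_mul] at h2
  linarith

variable {ℱ : Filtration ℕ m₀} {T : Ω → ℕ∞} {E : ℕ → Set Ω}

open scoped Classical in
/-- The number of steps `k < min n T`. -/
def stepCount (T : Ω → ℕ∞) (n : ℕ) (ω : Ω) : ℕ :=
  ∑ k ∈ Finset.range n, if (k : ℕ∞) < T ω then 1 else 0

open scoped Classical in
/-- The number of steps `k < min n T` at which the event `E k` fails. -/
def badCount (T : Ω → ℕ∞) (E : ℕ → Set Ω) (n : ℕ) (ω : Ω) : ℕ :=
  ∑ k ∈ Finset.range n, if (k : ℕ∞) < T ω ∧ ω ∉ E k then 1 else 0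

theorem badCount_le (n : ℕ) (ω : Ω) : badCount T E n ω ≤ n := by
  classical
  calc badCount T E n ω ≤ ∑ _k ∈ Finset.range n, 1 :=
        Finset.sum_le_sum fun k _ => by split_ifs <;> simp
    _ = n := by simp

theorem stepCount_eq_of_lt {n : ℕ} {ω : Ω} (h : (n : ℕ∞) < T ω) : stepCount T n ω = n := by
  classical
  unfold stepCount
  rw [Finset.sum_congr rfl (g := fun _ => 1)]
  · simp
  · intro k hk
    rw [if_pos]
    exact lt_trans (by exact_mod_cast Finset.mem_range.mp hk) h

theorem measurable_badCount (hT : ∀ k : ℕ, MeasurableSet[ℱ k] {ω | (k : ℕ∞) < T ω})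
    (hE : ∀ k, MeasurableSet[ℱ (k + 1)] (E k)) (n : ℕ) :
    Measurable[ℱ n] (badCount T E n) := by
  classical
  refine Finset.measurable_fun_sum _ fun k hk => ?_
  have hk' : k + 1 ≤ n := Finset.mem_range.mp hk
  refine Measurable.ite ?_ measurable_const measurable_const
  exact MeasurableSet.inter (ℱ.mono (by omega) _ (hT k))
    (ℱ.mono hk' _ (hE k)).compl

/-- The weight `2 ^ (K * badCount)` on `{n < T}` grows by a factor of at most `3 / 2` per step. -/
theorem tail_weight_le (hT : ∀ k : ℕ, MeasurableSet[ℱ k] {ω | (k : ℕ∞) < T ω})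
    (hE : ∀ k, MeasurableSet[ℱ (k + 1)] (E k)) {K : ℕ}
    (hgood : ∀ k : ℕ, ∀ᵐ ω ∂P, (k : ℕ∞) < T ω →
      1 - (2 ^ (K + 1) : ℝ)⁻¹ ≤ (P[(E k).indicator (fun _ => (1 : ℝ)) | ℱ k]) ω) (n : ℕ) :
    ∫ ω, {ω | (n : ℕ∞) < T ω}.indicator (fun ω => (2 : ℝ) ^ (K * badCount T E n ω)) ω ∂P
      ≤ (3 / 2) ^ n := by
  classical
  set Y : ℕ → Ω → ℝ := fun n =>
    {ω | (n : ℕ∞) < T ω}.indicator (fun ω => (2 : ℝ) ^ (K * badCount T E n ω)) with hYdef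
  have hYm : ∀ n, StronglyMeasurable[ℱ n] (Y n) := fun n => by
    refine StronglyMeasurable.indicator ?_ (hT n)
    have h1 : Measurable[ℱ n] (fun ω => (2 : ℝ) ^ (K * badCount T E n ω)) :=
      (measurable_from_top (f := fun j : ℕ => (2 : ℝ) ^ (K * j))).comp
        (measurable_badCount hT hE n)
    exact h1.stronglyMeasurable
  have hY0 : ∀ n ω, 0 ≤ Y n ω := fun n ω => Set.indicator_nonneg (fun _ _ => by positivity) ω
  have hYb : ∀ n ω, ‖Y n ω‖ ≤ 2 ^ (K * n) := fun n ω => by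
    rw [Real.norm_of_nonneg (hY0 n ω)]
    refine Set.indicator_apply_le' (fun _ => ?_) (fun _ => by positivity)
    exact pow_le_pow_right₀ (by norm_num) (Nat.mul_le_mul_left _ (badCount_le n ω))
  have hYint : ∀ n, Integrable (Y n) P := fun n =>
    Integrable.of_bound ((hYm n).mono (ℱ.le n)).aestronglyMeasurable _
      (Filter.Eventually.of_forall (hYb n))
  change ∫ ω, Y n ω ∂P ≤ _
  induction n with
  | zero =>
    calc ∫ ω, Y 0 ω ∂P ≤ ∫ _ω, (1 : ℝ) ∂P :=
          integral_mono (hYint 0) (integrable_const _) fun ω => by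
            have := hYb 0 ω
            rw [Real.norm_of_nonneg (hY0 0 ω)] at this
            simpa using this
      _ = (3 / 2) ^ 0 := by simp
  | succ n ih =>
    have hEm : MeasurableSet (E n) := ℱ.le (n + 1) _ (hE n)
    have hbad := integral_mul_indicator_compl_le (P := P) (ℱ.le n)
      (A := {ω | (n : ℕ∞) < T ω}) hEm (hgood n) (hYm n) (hY0 n)
      (fun ω h => Set.indicator_of_notMem h _) (hYint n)
    have hint : Integrable (fun ω => Y n ω * (E n)ᶜ.indicator (fun _ => (1 : ℝ)) ω) P := by
      refine (hYint n).mul_bdd (c := 1)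
        ((integrable_const (1 : ℝ)).indicator hEm.compl).aestronglyMeasurable
        (Filter.Eventually.of_forall fun ω => ?_)
      by_cases h : ω ∈ E n <;> simp [h]
    -- A good step leaves the weight unchanged, a bad one multiplies it by `2 ^ K`, and leaving `{n
    -- < T}` sets it to zero.
    have hstep : ∀ ω, Y (n + 1) ω ≤
        Y n ω + 2 ^ K * (Y n ω * (E n)ᶜ.indicator (fun _ => (1 : ℝ)) ω) := fun ω => by
      by_cases h : ((n + 1 : ℕ) : ℕ∞) < T ω
      · have hn : (n : ℕ∞) < T ω := lt_trans (by exact_mod_cast Nat.lt_succ_self n) h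
        have e1 : Y (n + 1) ω = 2 ^ (K * badCount T E (n + 1) ω) :=
          Set.indicator_of_mem (s := {ω | ((n + 1 : ℕ) : ℕ∞) < T ω}) h _
        have e2 : Y n ω = 2 ^ (K * badCount T E n ω) :=
          Set.indicator_of_mem (s := {ω | (n : ℕ∞) < T ω}) hn _
        have e3 : badCount T E (n + 1) ω = badCount T E n ω + if ω ∉ E n then 1 else 0 := by
          rw [badCount, Finset.sum_range_succ]
          simp only [hn, true_and, badCount]
        rw [e1, e2, e3]
        by_cases hw : ω ∈ E n
        · simp [hw]
        · simp only [hw, not_false_eq_true, if_true, Set.mem_compl_iff, Set.indicator_of_mem,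
            mul_one, mul_add, pow_add]
          nlinarith [show (0 : ℝ) ≤ 2 ^ (K * badCount T E n ω) by positivity]
      · have e1 : Y (n + 1) ω = 0 :=
          Set.indicator_of_notMem (s := {ω | ((n + 1 : ℕ) : ℕ∞) < T ω}) h _
        rw [e1]
        have : 0 ≤ (E n)ᶜ.indicator (fun _ => (1 : ℝ)) ω :=
          Set.indicator_nonneg (fun _ _ => by norm_num) ω
        have := hY0 n ω
        positivity
    have := integral_mono (hYint (n + 1)) ((hYint n).add (hint.const_mul (2 ^ K))) hstep
    simp only [Pi.add_apply] at this
    rw [integral_add (hYint n) (hint.const_mul _), integral_const_mul] at this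
    -- The probability level `1 - 2 ^ (-(K + 1))` is chosen for this cancellation: the growth factor
    -- is `1 + 1 / 2`.
    have h2 : (2 : ℝ) ^ K * ((1 - (1 - (2 ^ (K + 1) : ℝ)⁻¹)) * ∫ ω, Y n ω ∂P)
        = 1 / 2 * ∫ ω, Y n ω ∂P := by
      rw [pow_succ]; field_simp; ring
    have h3 := mul_le_mul_of_nonneg_left hbad (show (0 : ℝ) ≤ 2 ^ K by positivity)
    rw [pow_succ]
    linarith

/-- Geometric tail of `T` when steps are bounded by `a` plus `K` times the number of bad steps. -/
theorem measureReal_lt_le (hT : ∀ k : ℕ, MeasurableSet[ℱ k] {ω | (k : ℕ∞) < T ω})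
    (hE : ∀ k, MeasurableSet[ℱ (k + 1)] (E k)) {K : ℕ}
    (hgood : ∀ k : ℕ, ∀ᵐ ω ∂P, (k : ℕ∞) < T ω →
      1 - (2 ^ (K + 1) : ℝ)⁻¹ ≤ (P[(E k).indicator (fun _ => (1 : ℝ)) | ℱ k]) ω)
    {a : ℝ} (hpath : ∀ ω n, (stepCount T n ω : ℝ) ≤ a + K * badCount T E n ω) (n : ℕ) :
    P.real {ω | (n : ℕ∞) < T ω} ≤ 2 ^ ⌈a⌉₊ * (3 / 4) ^ n := by
  have hA : MeasurableSet {ω | (n : ℕ∞) < T ω} := ℱ.le n _ (hT n)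
  have hw := tail_weight_le (P := P) hT hE hgood n
  have hint : Integrable
      ({ω | (n : ℕ∞) < T ω}.indicator (fun ω => (2 : ℝ) ^ (K * badCount T E n ω))) P := by
    refine Integrable.indicator ?_ hA
    refine Integrable.of_bound (C := 2 ^ (K * n)) ?_ (Filter.Eventually.of_forall fun ω => ?_)
    · have := (measurable_badCount hT hE n).mono (ℱ.le n) le_rfl
      exact ((measurable_from_top (f := fun j : ℕ => (2 : ℝ) ^ (K * j))).comp
        this).aestronglyMeasurable
    · rw [Real.norm_of_nonneg (by positivity)]
      exact pow_le_pow_right₀ (by norm_num) (Nat.mul_le_mul_left _ (badCount_le n ω))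
  -- Markov's inequality: on `{n < T}` the pathwise bound reads `n ≤ a + K * bad`, so the weight is
  -- large there.
  have hle : ∀ ω, {ω | (n : ℕ∞) < T ω}.indicator (fun _ => (2 : ℝ) ^ n) ω ≤
      2 ^ ⌈a⌉₊ *
        {ω | (n : ℕ∞) < T ω}.indicator (fun ω => (2 : ℝ) ^ (K * badCount T E n ω)) ω := by
    intro ω
    by_cases h : (n : ℕ∞) < T ω
    · rw [Set.indicator_of_mem (s := {ω | (n : ℕ∞) < T ω}) h,
        Set.indicator_of_mem (s := {ω | (n : ℕ∞) < T ω}) h, ← pow_add]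
      refine pow_le_pow_right₀ (by norm_num) ?_
      have h1 := hpath ω n
      rw [stepCount_eq_of_lt h] at h1
      have h2 := Nat.le_ceil a
      have : (n : ℝ) ≤ ⌈a⌉₊ + K * badCount T E n ω := by linarith
      exact_mod_cast this
    · rw [Set.indicator_of_notMem (s := {ω | (n : ℕ∞) < T ω}) h,
        Set.indicator_of_notMem (s := {ω | (n : ℕ∞) < T ω}) h, mul_zero]
  have := integral_mono ((integrable_const ((2 : ℝ) ^ n)).indicator hA) (hint.const_mul _) hle
  rw [integral_indicator hA, integral_const_mul] at this
  simp only [integral_const, MeasurableSet.univ, measureReal_restrict_apply, Set.univ_inter,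
    smul_eq_mul] at this
  have h4 : (3 / 4 : ℝ) ^ n = (3 / 2) ^ n / 2 ^ n := by rw [← div_pow]; norm_num
  rw [h4, ← mul_div_assoc, le_div_iff₀ (by positivity)]
  exact this.trans (mul_le_mul_of_nonneg_left hw (by positivity))

/-- With `s` the sum on the left, the expectation of the pathwise bound gives `s ≤ a + K 2 ^ (-(K +
1)) s ≤ a + s / 2`, because `K ≤ 2 ^ K`. Truncation at `n` keeps `s` finite, so that `s / 2` can be
absorbed. -/
theorem sum_measureReal_lt_le (hT : ∀ k : ℕ, MeasurableSet[ℱ k] {ω | (k : ℕ∞) < T ω})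
    (hE : ∀ k, MeasurableSet[ℱ (k + 1)] (E k)) {K : ℕ}
    (hgood : ∀ k : ℕ, ∀ᵐ ω ∂P, (k : ℕ∞) < T ω →
      1 - (2 ^ (K + 1) : ℝ)⁻¹ ≤ (P[(E k).indicator (fun _ => (1 : ℝ)) | ℱ k]) ω)
    {a : ℝ} (hpath : ∀ ω n, (stepCount T n ω : ℝ) ≤ a + K * badCount T E n ω) (n : ℕ) :
    ∑ k ∈ Finset.range n, P.real {ω | (k : ℕ∞) < T ω} ≤ 2 * a := by
  classical
  have hA : ∀ k : ℕ, MeasurableSet {ω | (k : ℕ∞) < T ω} := fun k => ℱ.le k _ (hT k)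
  have hEm : ∀ k, MeasurableSet (E k) := fun k => ℱ.le (k + 1) _ (hE k)
  set I : ℕ → Ω → ℝ := fun k => {ω | (k : ℕ∞) < T ω}.indicator (fun _ => (1 : ℝ)) with hI
  set J : ℕ → Ω → ℝ := fun k ω => I k ω * (E k)ᶜ.indicator (fun _ => (1 : ℝ)) ω with hJ
  have hIint : ∀ k, Integrable (I k) P := fun k => (integrable_const _).indicator (hA k)
  have hJint : ∀ k, Integrable (J k) P := fun k => by
    refine (hIint k).mul_bdd (c := 1)
      ((integrable_const (1 : ℝ)).indicator (hEm k).compl).aestronglyMeasurable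
      (Filter.Eventually.of_forall fun ω => ?_)
    by_cases h : ω ∈ E k <;> simp [h]
  have hII : ∀ k, ∫ ω, I k ω ∂P = P.real {ω | (k : ℕ∞) < T ω} := fun k => by
    simp [hI, integral_indicator (hA k)]
  have hJI : ∀ k, ∫ ω, J k ω ∂P ≤ (2 ^ (K + 1) : ℝ)⁻¹ * ∫ ω, I k ω ∂P := fun k => by
    have := integral_mul_indicator_compl_le (P := P) (ℱ.le k)
      (A := {ω | (k : ℕ∞) < T ω}) (hEm k) (hgood k)
      (Y := I k) (stronglyMeasurable_const.indicator (hT k))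
      (fun ω => Set.indicator_nonneg (fun _ _ => by norm_num) ω)
      (fun ω h => Set.indicator_of_notMem h _) (hIint k)
    simpa using this
  have hpt : ∀ ω, ∑ k ∈ Finset.range n, I k ω ≤ a + K * ∑ k ∈ Finset.range n, J k ω := by
    intro ω
    have h := hpath ω n
    have e1 : (stepCount T n ω : ℝ) = ∑ k ∈ Finset.range n, I k ω := by
      simp [stepCount, hI, Set.indicator_apply]
    have e2 : (badCount T E n ω : ℝ) = ∑ k ∈ Finset.range n, J k ω := by
      simp only [badCount, hI, hJ, Set.indicator_apply]
      push_cast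
      refine Finset.sum_congr rfl fun k _ => ?_
      by_cases h1 : (k : ℕ∞) < T ω <;> by_cases h2 : ω ∈ E k <;> simp [h1, h2]
    rwa [e1, e2] at h
  have hmono := integral_mono (μ := P) (integrable_finsetSum _ fun k _ => hIint k)
    ((integrable_const a).add
      ((integrable_finsetSum (Finset.range n) fun k _ => hJint k).const_mul (K : ℝ))) hpt
  simp only [Pi.add_apply] at hmono
  rw [integral_add (integrable_const a)
      ((integrable_finsetSum (Finset.range n) fun k _ => hJint k).const_mul (K : ℝ)),
    integral_const_mul, integral_finsetSum _ fun k _ => hIint k,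
    integral_finsetSum _ fun k _ => hJint k] at hmono
  simp only [integral_const, probReal_univ, one_smul, hII] at hmono
  set s := ∑ k ∈ Finset.range n, P.real {ω | (k : ℕ∞) < T ω} with hs
  have hs0 : 0 ≤ s := Finset.sum_nonneg fun k _ => measureReal_nonneg
  have hJs : ∑ k ∈ Finset.range n, ∫ ω, J k ω ∂P ≤ (2 ^ (K + 1) : ℝ)⁻¹ * s := by
    rw [hs, Finset.mul_sum]
    exact Finset.sum_le_sum fun k _ => by rw [← hII]; exact hJI k
  have hK : (K : ℝ) * (2 ^ (K + 1) : ℝ)⁻¹ ≤ 1 / 2 := by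
    have : (K : ℝ) ≤ 2 ^ K := by exact_mod_cast Nat.lt_two_pow_self.le
    rw [pow_succ, mul_inv, ← mul_assoc, ← div_eq_mul_inv (K : ℝ)]
    have := (div_le_one (show (0 : ℝ) < 2 ^ K by positivity)).mpr this
    linarith
  have h5 : (K : ℝ) * ∑ k ∈ Finset.range n, ∫ ω, J k ω ∂P ≤ 1 / 2 * s :=
    calc (K : ℝ) * ∑ k ∈ Finset.range n, ∫ ω, J k ω ∂P
        ≤ K * ((2 ^ (K + 1) : ℝ)⁻¹ * s) := by gcongr
      _ = (K * (2 ^ (K + 1) : ℝ)⁻¹) * s := by ring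
      _ ≤ 1 / 2 * s := by gcongr
  linarith

/-- The layer-cake form of `T`: it turns `E[T]` into the sum of the tails and yields measurability
of `T`. -/
theorem coe_eq_tsum_indicator (t : ℕ∞) :
    ((t : ℕ∞) : ENNReal) = ∑' k : ℕ, {k : ℕ | (k : ℕ∞) < t}.indicator (fun _ => (1 : ENNReal)) k := by
  have := ENNReal.tsum_set_one {k : ℕ | (k : ℕ∞) < t}
  rw [tsum_subtype {k : ℕ | (k : ℕ∞) < t} (fun _ => (1 : ENNReal))] at this
  rw [this]
  congr 1
  induction t using ENat.recTopCoe with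
  | top => simp
  | coe n =>
    have : {k : ℕ | (k : ℕ∞) < (n : ℕ∞)} = ↑(Finset.range n) := by ext; simp
    rw [this, Set.encard_coe_eq_coe_finsetCard, Finset.card_range]

/-- Expected hitting time, almost sure finiteness and finite moment generating function when
the number of steps is bounded pathwise by `a` plus `K` times the number of bad steps. -/
theorem hitting_time_bounds (hT : ∀ k : ℕ, MeasurableSet[ℱ k] {ω | (k : ℕ∞) < T ω})
    (hE : ∀ k, MeasurableSet[ℱ (k + 1)] (E k)) {K : ℕ}
    (hgood : ∀ k : ℕ, ∀ᵐ ω ∂P, (k : ℕ∞) < T ω →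
      1 - (2 ^ (K + 1) : ℝ)⁻¹ ≤ (P[(E k).indicator (fun _ => (1 : ℝ)) | ℱ k]) ω)
    {a : ℝ} (hpath : ∀ ω n, (stepCount T n ω : ℝ) ≤ a + K * badCount T E n ω) :
    ∫⁻ ω, ((T ω : ℕ∞) : ENNReal) ∂P ≤ ENNReal.ofReal (2 * a) ∧
      (∀ᵐ ω ∂P, T ω ≠ ⊤) ∧
      ∀ t : ℝ, |t| ≤ Real.log (5 / 4) →
        Integrable (fun ω => Real.exp (t * ((T ω).toNat : ℝ))) P := by
  have hA : ∀ k : ℕ, MeasurableSet {ω | (k : ℕ∞) < T ω} := fun k => ℱ.le k _ (hT k)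
  have hTsum : ∀ ω, ((T ω : ℕ∞) : ENNReal) =
      ∑' k : ℕ, {ω | (k : ℕ∞) < T ω}.indicator (fun _ => (1 : ENNReal)) ω := fun ω => by
    rw [coe_eq_tsum_indicator]; rfl
  have hTmeas : Measurable fun ω => ((T ω : ℕ∞) : ENNReal) := by
    simp_rw [hTsum]
    exact Measurable.tsum fun k => measurable_const.indicator (hA k)
  have hmean : ∫⁻ ω, ((T ω : ℕ∞) : ENNReal) ∂P ≤ ENNReal.ofReal (2 * a) := by
    simp_rw [hTsum]
    rw [lintegral_tsum fun k => (measurable_const.indicator (hA k)).aemeasurable]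
    refine ENNReal.tsum_le_of_sum_range_le fun n => ?_
    have : ∀ k : ℕ, ∫⁻ ω, {ω | (k : ℕ∞) < T ω}.indicator (fun _ => (1 : ENNReal)) ω ∂P
        = ENNReal.ofReal (P.real {ω | (k : ℕ∞) < T ω}) := fun k => by
      rw [lintegral_indicator (hA k)]
      simp
    simp_rw [this]
    rw [← ENNReal.ofReal_sum_of_nonneg fun k _ => measureReal_nonneg]
    exact ENNReal.ofReal_le_ofReal (sum_measureReal_lt_le hT hE hgood hpath n)
  refine ⟨hmean, ?_, ?_⟩
  · filter_upwards [ae_lt_top hTmeas (ne_top_of_le_ne_top ENNReal.ofReal_ne_top hmean)]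
      with ω hω h
    simp [h] at hω
  · intro t ht
    have hNmeas : Measurable fun ω => ((T ω).toNat : ℝ) := by
      have : (fun ω => ((T ω).toNat : ℝ)) = fun ω => (((T ω : ℕ∞) : ENNReal)).toReal := by
        funext ω
        cases h : T ω <;> simp
      rw [this]
      exact hTmeas.ennreal_toReal
    have hmeas : AEStronglyMeasurable (fun ω => Real.exp (t * ((T ω).toNat : ℝ))) P :=
      (Real.measurable_exp.comp (hNmeas.const_mul t)).aestronglyMeasurable
    -- For finite `T = n + 1` the single term of index `n` already suffices; the summand `1` covers
    -- `T = 0` and also `T = ⊤`, where `toNat` is `0`.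
    have hb : ∀ ω, ‖Real.exp (t * ((T ω).toNat : ℝ))‖ₑ ≤
        1 + ∑' n : ℕ, {ω | (n : ℕ∞) < T ω}.indicator
          (fun _ => ENNReal.ofReal ((5 / 4) ^ (n + 1))) ω := by
      intro ω
      have hexp : Real.exp (t * ((T ω).toNat : ℝ)) ≤ (5 / 4) ^ (T ω).toNat := by
        have : ((5 / 4 : ℝ)) ^ (T ω).toNat = Real.exp (Real.log (5 / 4) * ((T ω).toNat : ℝ)) := by
          rw [mul_comm, Real.exp_nat_mul, Real.exp_log (by norm_num)]
        rw [this]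
        exact Real.exp_le_exp.mpr (mul_le_mul_of_nonneg_right ((le_abs_self t).trans ht)
          (Nat.cast_nonneg _))
      rw [← ofReal_norm, Real.norm_of_nonneg (Real.exp_nonneg _)]
      refine (ENNReal.ofReal_le_ofReal hexp).trans ?_
      rcases h : (T ω).toNat with _ | n
      · simp
      · refine le_trans ?_ le_add_self
        refine le_trans ?_ (ENNReal.le_tsum n)
        have hn : (n : ℕ∞) < T ω := by
          cases hTω : T ω with
          | top => simp
          | coe j =>
            rw [hTω] at h
            simp only [ENat.toNat_natCast] at h
            exact_mod_cast (by omega : n < j)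
        rw [Set.indicator_of_mem (s := {ω | (n : ℕ∞) < T ω}) hn]
    refine ⟨hmeas, ?_⟩
    refine lt_of_le_of_lt (lintegral_mono hb) ?_
    rw [lintegral_add_left measurable_const,
      lintegral_tsum fun k => (measurable_const.indicator (hA k)).aemeasurable]
    refine ENNReal.add_lt_top.mpr ⟨by simp, ?_⟩
    -- The growth `5/4` is beaten by the tail `3/4`, since their product `15/16` is below `1`.
    have hle : ∀ n : ℕ, ∫⁻ ω, {ω | (n : ℕ∞) < T ω}.indicator
        (fun _ => ENNReal.ofReal ((5 / 4) ^ (n + 1))) ω ∂P ≤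
        ENNReal.ofReal (5 / 4 * 2 ^ ⌈a⌉₊ * (15 / 16) ^ n) := fun n => by
      rw [lintegral_indicator (hA n), setLIntegral_const, ← ofReal_measureReal,
        ← ENNReal.ofReal_mul (by positivity)]
      refine ENNReal.ofReal_le_ofReal ?_
      calc (5 / 4 : ℝ) ^ (n + 1) * P.real {ω | (n : ℕ∞) < T ω}
          ≤ (5 / 4 : ℝ) ^ (n + 1) * (2 ^ ⌈a⌉₊ * (3 / 4) ^ n) := by
            gcongr
            exact measureReal_lt_le hT hE hgood hpath n
        _ = 5 / 4 * 2 ^ ⌈a⌉₊ * (15 / 16) ^ n := by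
            rw [show (15 / 16 : ℝ) = 5 / 4 * (3 / 4) by norm_num, mul_pow]; ring
    refine lt_of_le_of_lt (ENNReal.tsum_le_tsum hle) ?_
    have hs : Summable fun n : ℕ => (5 / 4 * 2 ^ ⌈a⌉₊ * (15 / 16) ^ n : ℝ) :=
      (summable_geometric_of_lt_one (by norm_num) (by norm_num)).mul_left _
    rw [← ENNReal.ofReal_tsum_of_nonneg (fun n => by positivity) hs]
    exact ENNReal.ofReal_lt_top

/-- A nonnegative potential that falls by `θ` at good steps and rises by at most `(K - 1) θ` at bad
ones bounds the number of steps by the number of bad steps. -/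
theorem stepCount_le_of_potential {ω : Ω} {Φ : ℕ → ℝ} {θ : ℝ} (hθ : 0 < θ) {K : ℕ}
    (hΦ : ∀ k, 0 ≤ Φ k)
    (hgood : ∀ k : ℕ, (k : ℕ∞) < T ω → ω ∈ E k → Φ (k + 1) ≤ Φ k - θ)
    (hbad : ∀ k : ℕ, (k : ℕ∞) < T ω → Φ (k + 1) ≤ Φ k - θ + K * θ)
    (hfrozen : ∀ k : ℕ, T ω ≤ k → Φ (k + 1) = Φ k) (n : ℕ) :
    (stepCount T n ω : ℝ) ≤ Φ 0 / θ + K * badCount T E n ω := by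
  classical
  -- Telescoped form of the one-step bounds; nonnegativity of `Φ n` then removes it.
  have key : ∀ n, θ * stepCount T n ω + Φ n ≤ Φ 0 + K * θ * badCount T E n ω := by
    intro n
    induction n with
    | zero => simp [stepCount, badCount]
    | succ n ih =>
      have e1 : stepCount T (n + 1) ω = stepCount T n ω + if (n : ℕ∞) < T ω then 1 else 0 := by
        rw [stepCount, Finset.sum_range_succ, stepCount]
      have e2 : badCount T E (n + 1) ω =
          badCount T E n ω + if (n : ℕ∞) < T ω ∧ ω ∉ E n then 1 else 0 := by
        rw [badCount, Finset.sum_range_succ, badCount]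
      rw [e1, e2]
      by_cases h : (n : ℕ∞) < T ω
      · by_cases hw : ω ∈ E n
        · have := hgood n h hw
          simp only [h, hw, if_true, not_true, and_false, if_false]
          push_cast
          linarith
        · have := hbad n h
          simp only [h, hw, if_true, not_false_eq_true, and_true]
          push_cast
          linarith
      · have := hfrozen n (not_lt.mp h)
        simp only [h, if_false, false_and, add_zero]
        linarith
  have := key n
  rw [div_add' _ _ _ hθ.ne', le_div_iff₀ hθ]
  nlinarith [hΦ n]

end HittingTime

/-! ### Vertices of a polytope and the pairwise gap. -/

section Polytope

variable {d m : ℕ} {A : Matrix (Fin m) (Fin d) ℝ} {b : Fin m → ℝ}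

/-- The `j`-th row of `A` as a vector of Euclidean space. -/
def rowVec (A : Matrix (Fin m) (Fin d) ℝ) (j : Fin m) : EuclideanSpace ℝ (Fin d) :=
  WithLp.toLp 2 (A j)

theorem mulVec_eq_inner (A : Matrix (Fin m) (Fin d) ℝ) (x : EuclideanSpace ℝ (Fin d))
    (j : Fin m) : A.mulVec (WithLp.ofLp x) j = inner ℝ (rowVec A j) x := by
  simp [Matrix.mulVec, dotProduct, rowVec, PiLp.inner_apply, mul_comm]

theorem mem_polytope {x : EuclideanSpace ℝ (Fin d)} :
    x ∈ polytope A b ↔ ∀ j, inner ℝ (rowVec A j) x ≤ b j := by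
  simp [polytope, mulVec_eq_inner]

theorem isClosed_polytope : IsClosed (polytope A b) := by
  have : polytope A b = ⋂ j, {x | inner ℝ (rowVec A j) x ≤ b j} := by
    ext x; simp [mem_polytope]
  rw [this]
  exact isClosed_iInter fun j => isClosed_le (by fun_prop) continuous_const

theorem convex_polytope : Convex ℝ (polytope A b) := by
  intro x hx y hy s t hs ht hst
  rw [mem_polytope] at *
  intro j
  rw [inner_add_right, inner_smul_right, inner_smul_right]
  calc s * inner ℝ (rowVec A j) x + t * inner ℝ (rowVec A j) y
      ≤ s * b j + t * b j := by
        gcongr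
        · exact hx j
        · exact hy j
    _ = b j := by rw [← add_mul, hst, one_mul]

theorem isCompact_polytope (hbdd : Bornology.IsBounded (polytope A b)) :
    IsCompact (polytope A b) :=
  Metric.isCompact_of_isClosed_isBounded isClosed_polytope hbdd

/-- Two extreme points of a polytope with the same active constraints are equal. -/
theorem eq_of_active_eq {u w : EuclideanSpace ℝ (Fin d)}
    (hu : u ∈ (polytope A b).extremePoints ℝ) (hw : w ∈ (polytope A b).extremePoints ℝ)
    (h : ∀ j, inner ℝ (rowVec A j) u = b j → inner ℝ (rowVec A j) w = b j) : u = w := by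
  have hu1 := mem_polytope.mp hu.1
  -- The segment from `w` to `u` can be prolonged slightly beyond `u`: constraints tight at `u` are
  -- tight at `w` and stay constant, the others have room. Extremality of `u` then forces `u = w`.
  have hev : ∀ᶠ t in nhdsWithin (0 : ℝ) (Set.Ioi 0), u + t • (u - w) ∈ polytope A b := by
    simp_rw [mem_polytope]
    rw [Filter.eventually_all]
    intro j
    rcases (hu1 j).eq_or_lt with hj | hj
    · refine Filter.Eventually.of_forall fun t => ?_
      rw [inner_add_right, inner_smul_right, inner_sub_right, h j hj, hj]
      simp
    · have hc : Filter.Tendsto (fun t : ℝ => inner ℝ (rowVec A j) (u + t • (u - w))) (nhds 0)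
          (nhds (inner ℝ (rowVec A j) (u + (0 : ℝ) • (u - w)))) :=
        Continuous.tendsto (by fun_prop) 0
      rw [zero_smul, add_zero] at hc
      exact ((hc.eventually (gt_mem_nhds hj)).filter_mono nhdsWithin_le_nhds).mono
        fun t ht => le_of_lt ht
  obtain ⟨t, ht, ht0⟩ := (hev.and self_mem_nhdsWithin).exists
  have ht0 : 0 < t := ht0
  have hseg : u ∈ openSegment ℝ (u + t • (u - w)) w := by
    refine ⟨1 / (1 + t), t / (1 + t), by positivity, by positivity, by field_simp, ?_⟩
    have h1 : (1 / (1 + t)) * t = t / (1 + t) := by ring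
    have h2 : (1 / (1 + t)) + t / (1 + t) = 1 := by field_simp
    rw [smul_add, smul_smul, h1, add_assoc, ← smul_add, sub_add_cancel, ← add_smul, h2, one_smul]
  have h2 : t • (u - w) = 0 := by simpa using hu.2 ht hw.1 hseg
  rcases smul_eq_zero.mp h2 with h3 | h3
  · exact absurd h3 ht0.ne'
  · exact sub_eq_zero.mp h3

/-- A vertex is determined by its set of tight constraints, and there are finitely many such sets.
-/
theorem finite_extremePoints_polytope : ((polytope A b).extremePoints ℝ).Finite := by
  refine Set.Finite.of_finite_image
    (f := fun u => {j : Fin m | inner ℝ (rowVec A j) u = b j}) (Set.toFinite _) ?_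
  intro u hu w hw h
  exact eq_of_active_eq hu hw fun j hj => (Set.ext_iff.mp h j).mp hj

/-- The positive slacks of the vertices of a polytope are bounded away from zero. -/
theorem exists_slack_lower_bound (A : Matrix (Fin m) (Fin d) ℝ) (b : Fin m → ℝ) :
    ∃ ξ : ℝ, 0 < ξ ∧ ∀ u ∈ (polytope A b).extremePoints ℝ, ∀ j,
      0 < b j - inner ℝ (rowVec A j) u → ξ ≤ b j - inner ℝ (rowVec A j) u := by
  have hfin : ((fun q : EuclideanSpace ℝ (Fin d) × Fin m => b q.2 - inner ℝ (rowVec A q.2) q.1) ''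
      (((polytope A b).extremePoints ℝ) ×ˢ (Set.univ : Set (Fin m)))).Finite :=
    (finite_extremePoints_polytope.prod Set.finite_univ).image _
  have hev : ∀ᶠ ξ in nhdsWithin (0 : ℝ) (Set.Ioi 0), ∀ r ∈ _, 0 < r → ξ ≤ r :=
    (Filter.eventually_all_finite hfin).mpr fun r _ => by
      by_cases hr : 0 < r
      · exact (Filter.Eventually.filter_mono nhdsWithin_le_nhds (gt_mem_nhds hr)).mono
          fun ξ h _ => le_of_lt h
      · exact Filter.Eventually.of_forall fun _ h => absurd h hr
  obtain ⟨ξ, h, h0⟩ := (hev.and self_mem_nhdsWithin).exists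
  exact ⟨ξ, h0, fun u hu j hj => h _ ⟨(u, j), ⟨hu, trivial⟩, rfl⟩ hj⟩

/-- A bounded polytope has no recession direction. -/
theorem eq_zero_of_recession (hbdd : Bornology.IsBounded (polytope A b))
    {x e : EuclideanSpace ℝ (Fin d)} (hx : x ∈ polytope A b)
    (he : ∀ j, inner ℝ (rowVec A j) e ≤ 0) : e = 0 := by
  obtain ⟨R, hR⟩ := hbdd.exists_norm_le
  by_contra hne
  have hpos : 0 < ‖e‖ := norm_pos_iff.mpr hne
  obtain ⟨n, hn⟩ := exists_nat_gt ((R + ‖x‖) / ‖e‖)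
  have hmem : x + (n : ℝ) • e ∈ polytope A b := by
    rw [mem_polytope] at *
    intro j
    rw [inner_add_right, inner_smul_right]
    have := mul_nonpos_of_nonneg_of_nonpos (Nat.cast_nonneg (α := ℝ) n) (he j)
    linarith [hx j]
  have h1 := hR _ hmem
  have h2 : ‖(n : ℝ) • e‖ ≤ R + ‖x‖ := by
    have := norm_sub_le (x + (n : ℝ) • e) x
    rw [add_sub_cancel_left] at this
    linarith
  rw [norm_smul, Real.norm_natCast] at h2
  rw [div_lt_iff₀ hpos] at hn
  linarith

/-- In the linear program that minimizes `∑ Δ` subject to `0 ≤ Δ ≤ α` and `∑ Δ i * σ i j ≥ r j`, an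
optimal solution exists, and each of its positive coordinates meets a tight constraint. -/
theorem exists_min_transport {ι : Type*} [Fintype ι] {J : Type*} [Finite J] {α : ι → ℝ}
    (hα : 0 ≤ α) {σ : ι → J → ℝ} (hσ : ∀ i j, 0 ≤ σ i j) {r : J → ℝ}
    (hr : ∀ j, r j ≤ ∑ i, α i * σ i j) :
    ∃ Δ : ι → ℝ, 0 ≤ Δ ∧ Δ ≤ α ∧ (∀ j, r j ≤ ∑ i, Δ i * σ i j) ∧
      ∀ i, 0 < Δ i → ∃ j, 0 < σ i j ∧ r j = ∑ i, Δ i * σ i j := by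
  classical
  set F : Set (ι → ℝ) := Set.Icc 0 α ∩ ⋂ j, {Δ | r j ≤ ∑ i, Δ i * σ i j} with hF
  -- The cap `Δ ≤ α` makes the feasible set compact, and `α` itself is feasible.
  have hFc : IsCompact F := isCompact_Icc.inter_right
    (isClosed_iInter fun j => isClosed_le continuous_const (by fun_prop))
  have hFn : F.Nonempty := ⟨α, ⟨hα, le_rfl⟩, Set.mem_iInter.mpr hr⟩
  obtain ⟨Δ, ⟨⟨h0, h1⟩, h2⟩, hmin⟩ :=
    hFc.exists_isMinOn hFn (f := fun Δ => ∑ i, Δ i) (by fun_prop)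
  have h2 := Set.mem_iInter.mp h2
  refine ⟨Δ, h0, h1, h2, fun i hi => ?_⟩
  by_contra! hno
  have hlt : ∀ j, 0 < σ i j → r j < ∑ i, Δ i * σ i j := fun j hj =>
    lt_of_le_of_ne (h2 j) (hno j hj)
  have hsum : ∀ (t : ℝ) (c : ι → ℝ),
      ∑ k, (Δ - (Pi.single i t : ι → ℝ)) k * c k = ∑ k, Δ k * c k - t * c i := fun t c => by
    simp [sub_mul, Finset.sum_sub_distrib, Pi.single_apply]
  -- If every constraint involving coordinate `i` were slack, `Δ i` could be lowered a little,
  -- against minimality.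
  have hev : ∀ᶠ t in nhdsWithin (0 : ℝ) (Set.Ioi 0),
      t ≤ Δ i ∧ ∀ j, r j ≤ ∑ k, Δ k * σ k j - t * σ i j := by
    refine Filter.Eventually.and ?_ (Filter.eventually_all.mpr fun j => ?_)
    · exact (Filter.Eventually.filter_mono nhdsWithin_le_nhds (gt_mem_nhds hi)).mono
        fun _ => le_of_lt
    · rcases (hσ i j).eq_or_lt with hj | hj
      · exact Filter.Eventually.of_forall fun t => by rw [← hj]; simpa using h2 j
      · have hc : Filter.Tendsto (fun t : ℝ => ∑ k, Δ k * σ k j - t * σ i j) (nhds 0)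
            (nhds (∑ k, Δ k * σ k j - 0 * σ i j)) := Continuous.tendsto (by fun_prop) 0
        rw [zero_mul, sub_zero] at hc
        exact ((hc.eventually (lt_mem_nhds (hlt j hj))).filter_mono nhdsWithin_le_nhds).mono
          fun _ => le_of_lt
  obtain ⟨t, ⟨ht1, ht2⟩, ht0⟩ := (hev.and self_mem_nhdsWithin).exists
  have ht0 : 0 < t := ht0
  have hmem : Δ - Pi.single i t ∈ F := by
    refine ⟨⟨fun k => ?_, fun k => ?_⟩, Set.mem_iInter.mpr fun j => ?_⟩
    · by_cases hk : k = i
      · subst hk; simpa using ht1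
      · simpa [hk] using h0 k
    · have : 0 ≤ (Pi.single i t : ι → ℝ) k := by
        by_cases hk : k = i
        · subst hk; simpa using ht0.le
        · simp [hk]
      have := h1 k
      simp only [Pi.sub_apply]
      linarith
    · change r j ≤ ∑ k, (Δ - (Pi.single i t : ι → ℝ)) k * σ k j
      rw [hsum]; exact ht2 j
  have h3 : ∑ k, Δ k ≤ ∑ k, (Δ - (Pi.single i t : ι → ℝ)) k := hmin hmem
  have h4 := hsum t 1
  simp only [Pi.one_apply, mul_one] at h4
  linarith

/-- Linear growth of the pairwise gap: on a bounded polytope, the decrease rate of a linear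
function from a vertex combination `x` towards any feasible `y` is controlled by the gap between
the active away vertex and the minimizing vertex. -/
theorem exists_pairwise_gap_constant (hbdd : Bornology.IsBounded (polytope A b)) :
    ∃ c : ℝ, 0 < c ∧ ∀ (α : EuclideanSpace ℝ (Fin d) →₀ ℝ) (x y g s v : EuclideanSpace ℝ (Fin d)),
      IsVertexRep (polytope A b) α x → y ∈ polytope A b → IsLPVertex (polytope A b) g s →
      IsAwayVertex α g v → inner ℝ g (x - y) ≤ c * ‖x - y‖ * inner ℝ g (v - s) := by
  obtain ⟨ξ, hξ, hslack⟩ := exists_slack_lower_bound A b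
  set Λ : ℝ := ∑ j, ‖rowVec A j‖ with hΛ
  have hΛ0 : 0 ≤ Λ := Finset.sum_nonneg fun _ _ => norm_nonneg _
  -- The `+ 1` keeps the constant positive even if all rows vanish.
  refine ⟨(Λ + 1) / ξ, by positivity, ?_⟩
  intro α x y g s v ⟨hα0, hαV, hα1, hαx⟩ hy hs hv
  have hx : ∑ u : α.support, α u • (u : EuclideanSpace ℝ (Fin d)) = x := by
    rw [← hαx, Finsupp.sum, Finset.sum_coe_sort α.support fun u => α u • u]
  have h1 : ∑ u : α.support, α u = 1 := by
    rw [← hα1, Finsupp.sum, Finset.sum_coe_sort α.support fun u => α u]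
  have hV : ∀ u : α.support, (u : EuclideanSpace ℝ (Fin d)) ∈ (polytope A b).extremePoints ℝ :=
    fun u => hαV u.2
  set σ : α.support → Fin m → ℝ := fun u j => b j - inner ℝ (rowVec A j) (u : EuclideanSpace ℝ _)
    with hσ
  have hσ0 : ∀ u j, 0 ≤ σ u j := fun u j => sub_nonneg.mpr (mem_polytope.mp (hV u).1 j)
  have hsumσ : ∀ (Δ : α.support → ℝ) j, ∑ u, Δ u * σ u j =
      (∑ u, Δ u) * b j - inner ℝ (rowVec A j) (∑ u, Δ u • (u : EuclideanSpace ℝ _)) := by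
    intro Δ j
    simp only [hσ, mul_sub, Finset.sum_sub_distrib, inner_sum, inner_smul_right, Finset.sum_mul]
  -- The displacement `y - x` is realized by taking mass `Δ u` from the active vertices and placing
  -- the total `t` at one point `z`, so `y - x = t z - w`. The constraints say exactly that `z` is
  -- feasible when `t > 0`, and the transported mass is minimal.
  obtain ⟨Δ, hΔ0, -, hΔr, htight⟩ := exists_min_transport
    (α := fun u : α.support => α u) (fun u => hα0 u) hσ0
    (r := fun j => inner ℝ (rowVec A j) (y - x)) (fun j => by
      rw [hsumσ, h1, hx, one_mul, inner_sub_right]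
      linarith [mem_polytope.mp hy j])
  set t : ℝ := ∑ u, Δ u with ht
  set w : EuclideanSpace ℝ (Fin d) := ∑ u, Δ u • (u : EuclideanSpace ℝ (Fin d)) with hw
  have ht0 : 0 ≤ t := Finset.sum_nonneg fun u _ => hΔ0 u
  have hgap : 0 ≤ inner ℝ g (v - s) := by
    rw [inner_sub_right]
    linarith [hs.2 v (hαV hv.1).1]
  -- Each vertex that gives up mass has slack at least `ξ` in some tight row of the program. Summing
  -- over the tight rows bounds `t ξ` by the sum of the `inner ℝ (rowVec A j) (y - x)`, hence by `Λ
  -- ‖x - y‖`.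
  have htle : t * ξ ≤ (Λ + 1) * ‖x - y‖ := by
    classical
    set I : Fin m → Prop := fun j => inner ℝ (rowVec A j) (y - x) = ∑ u, Δ u * σ u j with hI
    have hpt : ∀ u, Δ u * ξ ≤ ∑ j, if I j then Δ u * σ u j else 0 := by
      intro u
      have hnn : ∀ j ∈ Finset.univ, (0 : ℝ) ≤ if I j then Δ u * σ u j else 0 := fun j _ => by
        split_ifs
        · exact mul_nonneg (hΔ0 u) (hσ0 u j)
        · exact le_rfl
      rcases (hΔ0 u).eq_or_lt with h | h
      · rw [← h]; simp
      · obtain ⟨j, hj1, hj2⟩ := htight u h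
        have hIj : I j := hj2
        refine le_trans ?_ (Finset.single_le_sum hnn (Finset.mem_univ j))
        rw [if_pos hIj]
        exact mul_le_mul_of_nonneg_left (hslack u (hV u) j hj1) (hΔ0 u)
    calc t * ξ = ∑ u, Δ u * ξ := by rw [ht, Finset.sum_mul]
      _ ≤ ∑ u, ∑ j, (if I j then Δ u * σ u j else 0) := Finset.sum_le_sum fun u _ => hpt u
      _ = ∑ j, ∑ u, (if I j then Δ u * σ u j else 0) := Finset.sum_comm
      _ ≤ ∑ j, ‖rowVec A j‖ * ‖x - y‖ := by
        refine Finset.sum_le_sum fun j _ => ?_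
        by_cases hj : I j
        · simp only [if_pos hj]
          have hj' : inner ℝ (rowVec A j) (y - x) = ∑ u, Δ u * σ u j := hj
          rw [← hj', norm_sub_rev x y]
          exact real_inner_le_norm _ _
        · simp only [if_neg hj, Finset.sum_const_zero]
          positivity
      _ = Λ * ‖x - y‖ := by rw [hΛ, Finset.sum_mul]
      _ ≤ (Λ + 1) * ‖x - y‖ := by
        gcongr
        linarith
  have hmain : inner ℝ g (x - y) ≤ t * inner ℝ g (v - s) := by
    have hwv : inner ℝ g w ≤ t * inner ℝ g v := by
      rw [hw, ht, inner_sum, Finset.sum_mul]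
      refine Finset.sum_le_sum fun u _ => ?_
      rw [inner_smul_right]
      exact mul_le_mul_of_nonneg_left (hv.2 u u.2) (hΔ0 u)
    rcases ht0.eq_or_lt with h | h
    -- No mass moved means that `y - x` is a recession direction, so `y = x` by boundedness.
    · have hΔz : ∀ u, Δ u = 0 := fun u =>
        (Finset.sum_eq_zero_iff_of_nonneg fun u _ => hΔ0 u).mp h.symm u (Finset.mem_univ u)
      have hxK : x ∈ polytope A b := by
        rw [mem_polytope]
        intro j
        have := hsumσ (fun u => α u) j
        rw [h1, hx, one_mul] at this
        have h2 : 0 ≤ ∑ u : α.support, α u * σ u j :=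
          Finset.sum_nonneg fun u _ => mul_nonneg (hα0 u) (hσ0 u j)
        linarith
      have : y - x = 0 := eq_zero_of_recession hbdd hxK fun j => by
        have := hΔr j
        simpa [hΔz] using this
      rw [← neg_sub y x, this, ← h]
      simp
    · have hz : t⁻¹ • (y - x + w) ∈ polytope A b := by
        rw [mem_polytope]
        intro j
        have := hΔr j
        rw [hsumσ] at this
        rw [inner_smul_right, inner_add_right, inv_mul_le_iff₀ h]
        linarith
      have h3 := hs.2 _ hz
      rw [inner_smul_right, inner_add_right, ← neg_sub x y, inner_neg_right,
        le_inv_mul_iff₀ h] at h3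
      rw [inner_sub_right g v s, mul_sub]
      linarith
  refine hmain.trans ?_
  refine mul_le_mul_of_nonneg_right ?_ hgap
  rw [div_mul_eq_mul_div, le_div_iff₀ hξ]
  exact htle

end Polytope

/-! ### Smoothness, strong convexity and measurability of the objective. -/

section Objective

variable {d : ℕ} {K : Set (EuclideanSpace ℝ (Fin d))} {L μ M ε : ℝ}
  {f : EuclideanSpace ℝ (Fin d) → ℝ} {f' : EuclideanSpace ℝ (Fin d) → EuclideanSpace ℝ (Fin d)}

theorem IsObjective.continuousOn (hf : IsObjective K L μ f f') : ContinuousOn f K := fun x hx =>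
  (hf.hasGradient x hx).hasFDerivWithinAt.continuousWithinAt

theorem IsObjective.continuousOn_gradient (hf : IsObjective K L μ f f') : ContinuousOn f' K := by
  have : LipschitzOnWith (Real.toNNReal L) f' K := LipschitzOnWith.of_dist_le_mul fun x hx y hy => by
    rw [dist_eq_norm, dist_eq_norm]
    refine (hf.lipschitz x hx y hy).trans ?_
    gcongr
    exact Real.le_coe_toNNReal L
  exact this.continuousOn

/-- The descent lemma relative to a convex set. -/
theorem IsObjective.le_quadratic (hf : IsObjective K L μ f f') (hK : Convex ℝ K)
    {x y : EuclideanSpace ℝ (Fin d)} (hx : x ∈ K) (hy : y ∈ K) :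
    f y ≤ f x + inner ℝ (f' x) (y - x) + L / 2 * ‖y - x‖ ^ 2 := by
  set c : ℝ → EuclideanSpace ℝ (Fin d) := fun t => x + t • (y - x) with hc
  have hcK : Set.MapsTo c (Set.Icc 0 1) K := fun t ht => hK.add_smul_sub_mem hx hy ht
  have hcd : ∀ t, HasDerivAt c (y - x) t := fun t => by
    simpa [hc] using ((hasDerivAt_id t).smul_const (y - x)).const_add x
  have hderiv : ∀ t ∈ Set.Icc (0 : ℝ) 1,
      HasDerivWithinAt (f ∘ c) (inner ℝ (f' (c t)) (y - x)) (Set.Icc 0 1) t := fun t ht => by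
    have h1 := (hf.hasGradient (c t) (hcK ht)).hasFDerivWithinAt
    simpa using h1.comp_hasDerivWithinAt t (hcd t).hasDerivWithinAt hcK
  -- `φ` is `f` along the segment minus its quadratic model; the Lipschitz bound makes its
  -- derivative nonpositive. Only derivatives within `[0, 1]` are used, so relative
  -- differentiability suffices.
  set φ : ℝ → ℝ := fun t =>
    f (c t) - t * inner ℝ (f' x) (y - x) - t ^ 2 * (L / 2 * ‖y - x‖ ^ 2) with hφ
  have hφd : ∀ t ∈ Set.Icc (0 : ℝ) 1, HasDerivWithinAt φ
      (inner ℝ (f' (c t)) (y - x) - inner ℝ (f' x) (y - x) - t * (L * ‖y - x‖ ^ 2))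
      (Set.Icc 0 1) t := fun t ht => by
    have h2 : HasDerivAt (fun t : ℝ => t * inner ℝ (f' x) (y - x)) (inner ℝ (f' x) (y - x)) t := by
      simpa using (hasDerivAt_id t).mul_const (inner ℝ (f' x) (y - x))
    have h3 : HasDerivAt (fun t : ℝ => t ^ 2 * (L / 2 * ‖y - x‖ ^ 2)) (t * (L * ‖y - x‖ ^ 2)) t := by
      have := (hasDerivAt_pow 2 t).mul_const (L / 2 * ‖y - x‖ ^ 2)
      refine this.congr_deriv ?_
      push_cast
      ring
    exact ((hderiv t ht).sub h2.hasDerivWithinAt).sub h3.hasDerivWithinAt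
  have hanti : AntitoneOn φ (Set.Icc 0 1) := by
    refine antitoneOn_of_hasDerivWithinAt_nonpos (convex_Icc 0 1)
      (fun t ht => (hφd t ht).continuousWithinAt)
      (fun t ht => (hφd t (interior_subset ht)).mono interior_subset) fun t ht => ?_
    have ht := interior_subset ht
    rw [← inner_sub_left]
    have h1 := real_inner_le_norm (f' (c t) - f' x) (y - x)
    have h2 := hf.lipschitz (c t) (hcK ht) x hx
    have h3 : ‖c t - x‖ = t * ‖y - x‖ := by
      simp only [hc, add_sub_cancel_left, norm_smul, Real.norm_of_nonneg ht.1]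
    rw [h3] at h2
    have h4 := mul_le_mul_of_nonneg_right h2 (norm_nonneg (y - x))
    nlinarith
  have h01 := hanti (Set.left_mem_Icc.mpr zero_le_one) (Set.right_mem_Icc.mpr zero_le_one)
    zero_le_one
  simp only [hφ, hc, one_smul, zero_smul, add_zero, add_sub_cancel] at h01
  linarith

theorem optVal_le (hM : ∀ x ∈ K, |f x| ≤ M) {x : EuclideanSpace ℝ (Fin d)} (hx : x ∈ K) :
    optVal K f ≤ f x :=
  csInf_le ⟨-M, by rintro _ ⟨y, hy, rfl⟩; exact (abs_le.mp (hM y hy)).1⟩ ⟨x, hx, rfl⟩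

theorem sub_optVal_le (hM : ∀ x ∈ K, |f x| ≤ M) {x : EuclideanSpace ℝ (Fin d)} (hx : x ∈ K) :
    f x - optVal K f ≤ 2 * M := by
  have : -M ≤ optVal K f := le_csInf ⟨f x, x, hx, rfl⟩ (by
    rintro _ ⟨y, hy, rfl⟩; exact (abs_le.mp (hM y hy)).1)
  have := (abs_le.mp (hM x hx)).2
  linarith

theorem IsObjective.exists_minimizer (hf : IsObjective K L μ f f') (hK : IsCompact K)
    (hM : ∀ x ∈ K, |f x| ≤ M) {x : EuclideanSpace ℝ (Fin d)} (hx : x ∈ K) :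
    ∃ z ∈ K, f z = optVal K f := by
  obtain ⟨z, hz, hmin⟩ := hK.exists_isMinOn ⟨x, hx⟩ hf.continuousOn
  refine ⟨z, hz, le_antisymm (le_csInf ⟨f x, x, hx, rfl⟩ ?_) (optVal_le hM hz)⟩
  rintro _ ⟨y, hy, rfl⟩
  exact hmin hy

/-- A start with a positive optimality gap forces the parameters to be positive. -/
theorem IsObjective.parameters_pos (hf : IsObjective K L μ f f') (hK : IsCompact K) (hμ : 0 < μ)
    (hM : ∀ x ∈ K, |f x| ≤ M) (hε : 0 < ε) {x : EuclideanSpace ℝ (Fin d)} (hx : x ∈ K)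
    (hgap : ε < f x - optVal K f) : 0 < L ∧ 0 < Metric.diam K ∧ ε < 2 * M := by
  obtain ⟨z, hz, hzf⟩ := hf.exists_minimizer hK hM hx
  have hne : x ≠ z := by
    rintro rfl
    rw [hzf] at hgap
    linarith
  have hpos : 0 < ‖x - z‖ := norm_pos_iff.mpr (sub_ne_zero.mpr hne)
  have hL : 0 < L := by
    have h1 := hf.stronglyConvex x hx z hz
    have h2 := hf.stronglyConvex z hz x hx
    have h3 := real_inner_le_norm (f' x - f' z) (x - z)
    have h4 := mul_le_mul_of_nonneg_right (hf.lipschitz x hx z hz) (norm_nonneg (x - z))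
    rw [inner_sub_left] at h3
    rw [← neg_sub x z, inner_neg_right] at h1
    rw [norm_sub_rev z x] at h2
    -- Adding the two strong convexity inequalities shows that the gradient is strongly monotone, so
    -- `μ ≤ L`.
    have h5 : μ * ‖x - z‖ ^ 2 ≤ L * ‖x - z‖ ^ 2 := by nlinarith
    exact hμ.trans_le (le_of_mul_le_mul_right h5 (by positivity))
  refine ⟨hL, ?_, hgap.trans_le (sub_optVal_le hM hx)⟩
  refine lt_of_lt_of_le ?_ (Metric.dist_le_diam_of_mem hK.isBounded hx hz)
  rwa [dist_eq_norm]

theorem lt_hitTime_iff {x : ℕ → EuclideanSpace ℝ (Fin d)} {k : ℕ} :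
    (k : ℕ∞) < hitTime K f ε x ↔ ∀ j ≤ k, ε < f (x j) - optVal K f := by
  constructor
  · intro h j hj
    by_contra! hle
    have h1 : hitTime K f ε x ≤ (j : ℕ∞) := iInf₂_le j hle
    exact absurd (h.trans_le h1) (not_lt.mpr (by exact_mod_cast hj))
  · intro h
    have h1 : ((k + 1 : ℕ) : ℕ∞) ≤ hitTime K f ε x := le_iInf₂ fun j hj => by
      have : ¬ j ≤ k := fun hjk => absurd (h j hjk) (not_lt.mpr hj)
      exact_mod_cast (by omega : k + 1 ≤ j)
    exact lt_of_lt_of_le (by exact_mod_cast Nat.lt_succ_self k) h1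

/-- Nothing is known about `f` and `f'` off `K`, so measurability is obtained through the subtype,
using that the iterates stay in `K`. -/
theorem measurable_comp_of_continuousOn {Ω F : Type*} {m : MeasurableSpace Ω}
    [TopologicalSpace F] [MeasurableSpace F] [BorelSpace F]
    {h : EuclideanSpace ℝ (Fin d) → F} (hh : ContinuousOn h K)
    {X : Ω → EuclideanSpace ℝ (Fin d)} (hX : Measurable X) (hXK : ∀ ω, X ω ∈ K) :
    Measurable fun ω => h (X ω) := by
  have h1 : Measurable (K.domRestrict h) := (continuousOn_iff_continuous_domRestrict.mp hh).measurable
  exact h1.comp (hX.subtype_mk (h := hXK))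

theorem IsObjective.measurableSet_gradient_error_le {Ω : Type*} {m : MeasurableSpace Ω}
    (hf : IsObjective K L μ f f') {X G : Ω → EuclideanSpace ℝ (Fin d)} {c : Ω → ℝ}
    (hX : Measurable X) (hXK : ∀ ω, X ω ∈ K) (hG : Measurable G) (hc : Measurable c) :
    MeasurableSet {ω | ‖G ω - f' (X ω)‖ ≤ c ω} :=
  measurableSet_le
    (hG.sub (measurable_comp_of_continuousOn hf.continuousOn_gradient hX hXK)).norm hc

theorem measurableSet_lt_hitTime {Ω : Type*} {m₀ : MeasurableSpace Ω} {ℱ : Filtration ℕ m₀}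
    {X : ℕ → Ω → EuclideanSpace ℝ (Fin d)} (hf : ContinuousOn f K)
    (hX : ∀ k, Measurable[ℱ k] (X k)) (hXK : ∀ k ω, X k ω ∈ K) (k : ℕ) :
    MeasurableSet[ℱ k] {ω | (k : ℕ∞) < hitTime K f ε fun j => X j ω} := by
  simp_rw [lt_hitTime_iff, Set.ofPred_forall]
  refine MeasurableSet.iInter fun j => MeasurableSet.iInter fun hj => ?_
  have h1 : Measurable[ℱ k] (X j) := (hX j).mono (ℱ.mono hj) le_rfl
  have h2 := measurable_comp_of_continuousOn hf h1 (hXK j)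
  exact measurableSet_lt measurable_const (h2.sub_const _)

end Objective

/-! ### Standard Frank-Wolfe: decrease per step and complexity. -/

section FrankWolfe

variable {d : ℕ} {K : Set (EuclideanSpace ℝ (Fin d))} {L μ M ε : ℝ}
  {f : EuclideanSpace ℝ (Fin d) → ℝ} {f' : EuclideanSpace ℝ (Fin d) → EuclideanSpace ℝ (Fin d)}

theorem fwStepSize_pos (hL : 0 < L) (hD : 0 < Metric.diam K) (hε : 0 < ε) :
    0 < fwStepSize K L ε := by
  unfold fwStepSize
  positivity

theorem fwStepSize_le_one : fwStepSize K L ε ≤ 1 := min_le_left _ _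

theorem IsFWPath.mem {x g s : ℕ → EuclideanSpace ℝ (Fin d)} (hK : Convex ℝ K) (hL : 0 < L)
    (hD : 0 < Metric.diam K) (hε : 0 < ε) (h : IsFWPath K f L ε x g s) (h0 : x 0 ∈ K) (k : ℕ) :
    x k ∈ K := by
  induction k with
  | zero => exact h0
  | succ k ih =>
    by_cases hk : (k : ℕ∞) < hitTime K f ε x
    · rw [h.step k hk]
      exact hK.add_smul_sub_mem ih (h.lp k hk).1.1 ⟨(fwStepSize_pos hL hD hε).le, fwStepSize_le_one⟩
    · rw [h.frozen k (not_lt.mp hk)]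
      exact ih

/-- A Frank-Wolfe step with a good gradient estimate decreases the objective. -/
theorem IsObjective.fw_step_le (hf : IsObjective K L μ f f') (hK : Convex ℝ K)
    (hKb : Bornology.IsBounded K) (hμ : 0 < μ)
    (hL : 0 < L) (hD : 0 < Metric.diam K) (hε : 0 < ε) {x z g s : EuclideanSpace ℝ (Fin d)}
    (hx : x ∈ K) (hz : z ∈ K) (hs : IsLPVertex K g s) (hgap : ε < f x - f z)
    (hgood : ‖g - f' x‖ ≤ ε / (4 * Metric.diam K)) :
    f (x + fwStepSize K L ε • (s - x)) ≤ f x - fwStepSize K L ε * ε / 2 := by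
  set D := Metric.diam K with hDdef
  set γ := fwStepSize K L ε with hγdef
  have hγ0 : 0 < γ := fwStepSize_pos hL hD hε
  have hγ1 : γ ≤ 1 := fwStepSize_le_one
  have hγ2 : γ * (2 * L * D ^ 2) ≤ ε := by
    rw [← le_div_iff₀ (by positivity)]
    exact min_le_right _ _
  have hsK : s ∈ K := hs.1.1
  have hdesc := hf.le_quadratic hK hx (hK.add_smul_sub_mem hx hsK ⟨hγ0.le, hγ1⟩)
  rw [add_sub_cancel_left, inner_smul_right, norm_smul, Real.norm_of_nonneg hγ0.le] at hdesc
  have hnorm : ‖s - x‖ ≤ D := by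
    rw [← dist_eq_norm]; exact Metric.dist_le_diam_of_mem hKb hsK hx
  have hnorm' : ‖s - z‖ ≤ D := by
    rw [← dist_eq_norm]; exact Metric.dist_le_diam_of_mem hKb hsK hz
  have hconv := hf.stronglyConvex x hx z hz
  have hsq : 0 ≤ μ / 2 * ‖x - z‖ ^ 2 := by positivity
  have hlp := hs.2 z hz
  have herr : inner ℝ (f' x - g) (s - z) ≤ ε / 4 := by
    calc inner ℝ (f' x - g) (s - z) ≤ ‖f' x - g‖ * ‖s - z‖ := real_inner_le_norm _ _
      _ ≤ ε / (4 * D) * D := by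
        rw [norm_sub_rev]
        gcongr
      _ = ε / 4 := by field_simp
  -- The three terms are at most `-ε` (convexity), `ε / 4` (gradient error) and `0` (optimality of
  -- `s`). Comparing `s` with the minimizer `z` makes the error enter only once.
  have hsplit : inner ℝ (f' x) (s - x) =
      inner ℝ (f' x) (z - x) + inner ℝ (f' x - g) (s - z) + (inner ℝ g s - inner ℝ g z) := by
    simp only [inner_sub_left, inner_sub_right]
    ring
  have hdir : inner ℝ (f' x) (s - x) ≤ -(3 * ε / 4) := by linarith
  have h1 : γ * inner ℝ (f' x) (s - x) ≤ γ * -(3 * ε / 4) := mul_le_mul_of_nonneg_left hdir hγ0.le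
  have h2 : L / 2 * (γ * ‖s - x‖) ^ 2 ≤ γ * ε / 4 := by
    calc L / 2 * (γ * ‖s - x‖) ^ 2 ≤ L / 2 * (γ * D) ^ 2 := by gcongr
      _ = γ * (γ * (2 * L * D ^ 2)) / 4 := by ring
      _ ≤ γ * ε / 4 := by gcongr
  linarith

/-- Expected number of iterations and moment generating function of standard Frank-Wolfe. -/
theorem fw_complexity {Ω : Type*} {m₀ : MeasurableSpace Ω} {P : Measure Ω}
    [IsProbabilityMeasure P] {ℱ : Filtration ℕ m₀} (hf : IsObjective K L μ f f')
    (hK : Convex ℝ K) (hKc : IsCompact K) (hμ : 0 < μ) (hM : ∀ x ∈ K, |f x| ≤ M) (hε : 0 < ε)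
    {x₀ : EuclideanSpace ℝ (Fin d)} {X G S : ℕ → Ω → EuclideanSpace ℝ (Fin d)}
    (hproc : IsFWProcess ℱ K f L ε x₀ X G S) {N : ℕ}
    (hN : 2 * M / (fwStepSize K L ε * ε / 2) + 1 ≤ N)
    (hgood : GoodFW P ℱ K f f' ε (1 - (2 ^ (N + 1) : ℝ)⁻¹) X G)
    (hgap : ε < f x₀ - optVal K f) :
    ∫⁻ ω, ((hitTime K f ε fun k => X k ω : ℕ∞) : ENNReal) ∂P ≤
        ENNReal.ofReal (2 * ((f x₀ - optVal K f) / (fwStepSize K L ε * ε / 2))) ∧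
      (∀ᵐ ω ∂P, (hitTime K f ε fun k => X k ω) ≠ ⊤) ∧
      ∀ t : ℝ, |t| ≤ Real.log (5 / 4) → Integrable
        (fun ω => Real.exp (t * ((hitTime K f ε fun k => X k ω).toNat : ℝ))) P := by
  obtain ⟨hL, hD, -⟩ := hf.parameters_pos hKc hμ hM hε hproc.mem_init hgap
  obtain ⟨z, hz, hzf⟩ := hf.exists_minimizer hKc hM hproc.mem_init
  have hXK : ∀ k ω, X k ω ∈ K := fun k ω =>
    (hproc.path ω).mem hK hL hD hε (by simpa only [hproc.init ω] using hproc.mem_init) k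
  set θ := fwStepSize K L ε * ε / 2 with hθdef
  have hθ : 0 < θ := by
    have := fwStepSize_pos hL hD hε
    positivity
  refine hitting_time_bounds (ℱ := ℱ) (K := N)
    (E := fun k => {ω | ‖G k ω - f' (X k ω)‖ ≤ ε / (4 * Metric.diam K)})
    (measurableSet_lt_hitTime hf.continuousOn hproc.measurable_iterate hXK) (fun k => ?_) hgood
    fun ω n => ?_
  · have h1 : Measurable[ℱ (k + 1)] (X k) :=
      (hproc.measurable_iterate k).mono (ℱ.mono (Nat.le_succ k)) le_rfl
    exact hf.measurableSet_gradient_error_le h1 (hXK k) (hproc.measurable_gradient k)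
      measurable_const
  · have hpath := hproc.path ω
    have := stepCount_le_of_potential (T := fun ω => hitTime K f ε fun k => X k ω)
      (E := fun k => {ω | ‖G k ω - f' (X k ω)‖ ≤ ε / (4 * Metric.diam K)}) (ω := ω)
      (Φ := fun k => f (X k ω) - optVal K f) hθ (K := N)
      (fun k => sub_nonneg.mpr (optVal_le hM (hXK k ω))) (fun k hk hE => ?_) (fun k hk => ?_)
      (fun k hk => by rw [hpath.frozen k hk]) n
    · simpa only [hproc.init ω] using this
    · have hlt := lt_hitTime_iff.mp hk k le_rfl
      have := hf.fw_step_le hK hKc.isBounded hμ hL hD hε (hXK k ω) hz (hpath.lp k hk)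
        (by rw [hzf]; exact hlt) hE
      rw [← hpath.step k hk] at this
      linarith
    · have h1 := sub_optVal_le hM (hXK (k + 1) ω)
      have h2 := optVal_le hM (hXK k ω)
      -- A bad step raises the gap by at most `2 M`, which `(N - 1) θ` covers.
      have h3 : 2 * M + θ ≤ N * θ := by
        have := mul_le_mul_of_nonneg_right hN hθ.le
        rwa [add_mul, one_mul, div_mul_cancel₀ _ hθ.ne'] at this
      linarith

end FrankWolfe

/-! ### Away-step Frank-Wolfe: weights, potential and complexity. -/

section AwayStep

variable {d : ℕ} {K : Set (EuclideanSpace ℝ (Fin d))} {L μ M ε εg : ℝ}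
  {f : EuclideanSpace ℝ (Fin d) → ℝ} {f' : EuclideanSpace ℝ (Fin d) → EuclideanSpace ℝ (Fin d)}
  {α : EuclideanSpace ℝ (Fin d) →₀ ℝ} {x g s v : EuclideanSpace ℝ (Fin d)}

/-- Total mass and barycenter as linear maps of the weights, so that the weight update is handled by
linearity. -/
theorem isVertexRep_iff : IsVertexRep K α x ↔ (∀ u, 0 ≤ α u) ∧
    ↑α.support ⊆ K.extremePoints ℝ ∧ Finsupp.linearCombination ℝ (fun _ => (1 : ℝ)) α = 1 ∧
      Finsupp.linearCombination ℝ id α = x := by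
  simp [IsVertexRep, Finsupp.linearCombination_apply]

theorem IsVertexRep.mem (hK : Convex ℝ K) (h : IsVertexRep K α x) : x ∈ K := by
  obtain ⟨h0, hV, h1, hx⟩ := h
  rw [← hx]
  exact hK.sum_mem (fun u _ => h0 u) h1 fun u hu => (hV hu).1

theorem IsVertexRep.weight_le_one (h : IsVertexRep K α x) (u : EuclideanSpace ℝ (Fin d)) :
    α u ≤ 1 := by
  by_cases hu : u ∈ α.support
  · rw [← h.2.2.1]
    exact Finset.single_le_sum (f := fun u => α u) (fun w _ => h.1 w) hu
  · rw [Finsupp.notMem_support_iff.mp hu]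
    exact zero_le_one

theorem IsVertexRep.eq_of_weight_eq_one (h : IsVertexRep K α x)
    {u : EuclideanSpace ℝ (Fin d)} (hu : α u = 1) : x = u := by
  have hus : u ∈ α.support := by simp [hu]
  have h1 : α u + ∑ w ∈ α.support.erase u, α w = 1 := by
    rw [Finset.add_sum_erase α.support (fun w => α w) hus]
    exact h.2.2.1
  have h2 : ∑ w ∈ α.support.erase u, α w = 0 := by linarith
  have h3 := (Finset.sum_eq_zero_iff_of_nonneg fun w _ => h.1 w).mp h2
  rw [← h.2.2.2, Finsupp.sum, ← Finset.add_sum_erase α.support (fun w => α w • w) hus, hu,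
    one_smul, Finset.sum_eq_zero fun w hw => by rw [h3 w hw, zero_smul], add_zero]

theorem IsAwayVertex.gap_nonneg (hα : IsVertexRep K α x) (hs : IsLPVertex K g s)
    (hv : IsAwayVertex α g v) : 0 ≤ inner ℝ g (v - s) := by
  rw [inner_sub_right]
  linarith [hs.2 v (hα.2.1 hv.1).1]

/-- The selected direction achieves at least half of the pairwise gap. -/
theorem half_gap_le_awayDir : inner ℝ g (v - s) / 2 ≤ -(inner ℝ g (awayDir x g s v)) := by
  have h : inner ℝ g (v - s) = -(inner ℝ g (s - x)) + -(inner ℝ g (x - v)) := by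
    simp only [inner_sub_right]
    ring
  unfold awayDir
  split_ifs with hc
  · have : -(inner ℝ g (s - x)) ≥ -(inner ℝ g (x - v)) := hc
    linarith
  · have : -(inner ℝ g (s - x)) < -(inner ℝ g (x - v)) := not_le.mp hc
    linarith

theorem norm_awayDir_le (hKb : Bornology.IsBounded K) (hx : x ∈ K) (hs : s ∈ K) (hv : v ∈ K) :
    ‖awayDir x g s v‖ ≤ Metric.diam K := by
  unfold awayDir
  split_ifs
  · rw [← dist_eq_norm]; exact Metric.dist_le_diam_of_mem hKb hs hx
  · rw [← dist_eq_norm]; exact Metric.dist_le_diam_of_mem hKb hx hv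

/-- At an away step, the away vertex does not carry the whole weight. -/
theorem IsVertexRep.weight_lt_one (hK : Convex ℝ K) (hα : IsVertexRep K α x)
    (hs : IsLPVertex K g s) (hc : ¬ ChoosesFW x g s v) : α v < 1 := by
  -- Full weight at `v` means `x = v`; the away direction is then zero and the test selects a normal
  -- step.
  refine lt_of_le_of_ne (hα.weight_le_one v) fun h => hc ?_
  have hxv := hα.eq_of_weight_eq_one h
  have := hs.2 x (hα.mem hK)
  change -(inner ℝ g (s - x)) ≥ -(inner ℝ g (x - v))
  rw [hxv, sub_self, inner_zero_right, inner_sub_right, ← hxv]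
  linarith

theorem awayStepSize_nonneg (hL : 0 < L) (hα : IsVertexRep K α x)
    (hs : IsLPVertex K g s) (hv : IsAwayVertex α g v) : 0 ≤ awayStepSize L α x g s v := by
  refine le_min ?_ (div_nonneg ?_ (by positivity))
  · unfold awayMaxStep
    split_ifs with hc
    · exact zero_le_one
    · exact div_nonneg (hα.1 v) (sub_nonneg.mpr (hα.weight_le_one v))
  · have := half_gap_le_awayDir (x := x) (g := g) (s := s) (v := v)
    linarith [hv.gap_nonneg hα hs]

/-- The division-free form of the step-size bound also holds for a zero direction, where the
quotient is `0` by convention. -/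
theorem awayStepSize_mul_le (hL : 0 < L) (hα : IsVertexRep K α x)
    (hs : IsLPVertex K g s) (hv : IsAwayVertex α g v) :
    awayStepSize L α x g s v * (L * ‖awayDir x g s v‖ ^ 2) ≤
      -(inner ℝ g (awayDir x g s v)) := by
  have h0 : 0 ≤ L * ‖awayDir x g s v‖ ^ 2 := by positivity
  rcases h0.eq_or_lt with h | h
  · rw [← h, mul_zero]
    have := half_gap_le_awayDir (x := x) (g := g) (s := s) (v := v)
    linarith [hv.gap_nonneg hα hs]
  · rw [← le_div_iff₀ h]
    exact min_le_right _ _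

/-- The cap `γ_max` is what keeps the weights nonnegative: after an away step the weight of `v` is
`α v - γ (1 - α v)`. -/
theorem IsVertexRep.away_step (hL : 0 < L) (hK : Convex ℝ K) (hα : IsVertexRep K α x)
    (hs : IsLPVertex K g s) (hv : IsAwayVertex α g v) :
    IsVertexRep K (awayWeights L α x g s v)
      (x + awayStepSize L α x g s v • awayDir x g s v) := by
  have hγ0 := awayStepSize_nonneg hL hα hs hv
  have hγm : awayStepSize L α x g s v ≤ awayMaxStep α x g s v := min_le_left _ _
  obtain ⟨h0, hV, h1, hx⟩ := isVertexRep_iff.mp hα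
  set γ := awayStepSize L α x g s v with hγ
  rw [isVertexRep_iff]
  by_cases hc : ChoosesFW x g s v
  · simp only [awayMaxStep, if_pos hc] at hγm
    simp only [awayWeights, awayDir, if_pos hc, ← hγ]
    refine ⟨fun u => ?_, fun u hu => ?_, ?_, ?_⟩
    · have h2 : 0 ≤ Finsupp.single s γ u := by
        rw [Finsupp.single_apply]; split_ifs <;> [exact hγ0; exact le_rfl]
      have h3 := mul_nonneg (sub_nonneg.mpr hγm) (h0 u)
      simpa using add_nonneg h3 h2
    · by_cases hus : u = s
      · rw [hus]; exact hs.1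
      · refine hV (Finsupp.mem_support_iff.mpr fun hz => ?_)
        refine Finsupp.mem_support_iff.mp hu ?_
        simp [hz, Ne.symm hus]
    · rw [map_add, map_smul, h1, Finsupp.linearCombination_single]
      simp
    · rw [map_add, map_smul, hx, Finsupp.linearCombination_single, id, smul_sub, sub_smul,
        one_smul]
      abel
  · have hv1 := hα.weight_lt_one hK hs hc
    simp only [awayMaxStep, if_neg hc] at hγm
    rw [le_div_iff₀ (by linarith)] at hγm
    simp only [awayWeights, awayDir, if_neg hc, ← hγ]
    refine ⟨fun u => ?_, fun u hu => ?_, ?_, ?_⟩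
    · by_cases huv : u = v
      · subst huv
        simp only [Finsupp.coe_sub, Finsupp.coe_smul, Pi.sub_apply, Pi.smul_apply, smul_eq_mul,
          Finsupp.single_eq_same]
        linarith
      · simpa [Finsupp.single_apply, Ne.symm huv] using mul_nonneg (by linarith) (h0 u)
    · by_cases huv : u = v
      · rw [huv]; exact hV hv.1
      · refine hV (Finsupp.mem_support_iff.mpr fun hz => ?_)
        refine Finsupp.mem_support_iff.mp hu ?_
        simp [hz, Ne.symm huv]
    · rw [map_sub, map_smul, h1, Finsupp.linearCombination_single]
      simp
    · rw [map_sub, map_smul, hx, Finsupp.linearCombination_single, id, smul_sub, add_smul,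
        one_smul]
      abel

/-- A step activates at most one vertex. -/
theorem card_support_awayWeights_le (hv : IsAwayVertex α g v) :
    (awayWeights L α x g s v).support.card ≤ α.support.card + 1 := by
  classical
  have h : (awayWeights L α x g s v).support ⊆ insert s α.support := fun u hu => by
    by_contra hno
    simp only [Finset.mem_insert, not_or, Finsupp.mem_support_iff, not_not] at hno
    refine Finsupp.mem_support_iff.mp hu ?_
    have huv : v ≠ u := fun h => Finsupp.mem_support_iff.mp hv.1 (h ▸ hno.2)
    unfold awayWeights
    split_ifs <;> simp [hno.2, Ne.symm hno.1, huv]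
  exact (Finset.card_le_card h).trans (Finset.card_insert_le _ _)

/-- An away step of maximal length deactivates the away vertex. -/
theorem card_support_awayWeights_lt (hK : Convex ℝ K) (hα : IsVertexRep K α x)
    (hs : IsLPVertex K g s) (hv : IsAwayVertex α g v)
    (hc : ¬ ChoosesFW x g s v) (hmax : awayStepSize L α x g s v = awayMaxStep α x g s v) :
    (awayWeights L α x g s v).support.card + 1 ≤ α.support.card := by
  have hv1 := hα.weight_lt_one hK hs hc
  have h : (awayWeights L α x g s v).support ⊂ α.support := by
    refine Finset.ssubset_iff_of_subset (fun u hu => ?_) |>.mpr ⟨v, hv.1, ?_⟩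
    · by_cases huv : u = v
      · rw [huv]; exact hv.1
      · refine Finsupp.mem_support_iff.mpr fun hz => Finsupp.mem_support_iff.mp hu ?_
        simp [awayWeights, hc, hz, Ne.symm huv]
    · rw [Finsupp.notMem_support_iff]
      simp only [awayWeights, if_neg hc, hmax, awayMaxStep, Finsupp.coe_sub, Finsupp.coe_smul,
        Pi.sub_apply, Pi.smul_apply, smul_eq_mul, Finsupp.single_eq_same]
      have : 1 - α v ≠ 0 := by linarith
      field_simp
      ring
  exact Finset.card_lt_card h

/-- Decrease of the objective in a step with a good gradient estimate. -/
theorem IsObjective.away_step_le (hf : IsObjective K L μ f f') (hK : Convex ℝ K)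
    (hKb : Bornology.IsBounded K) (hL : 0 < L) (hεg : 0 < εg) (hα : IsVertexRep K α x)
    (hs : IsLPVertex K g s) (hv : IsAwayVertex α g v)
    (hgood : ‖g - f' x‖ ≤ εg * inner ℝ g (v - s)) :
    f (x + awayStepSize L α x g s v • awayDir x g s v) ≤ f x -
      (1 / 2 - 2 * Metric.diam K * εg) *
        (awayStepSize L α x g s v * -(inner ℝ g (awayDir x g s v))) := by
  have hγ0 := awayStepSize_nonneg hL hα hs hv
  have hγr := awayStepSize_mul_le hL hα hs hv
  have hxK := hα.mem hK
  have hdesc := hf.le_quadratic hK hxK ((hα.away_step hL hK hs hv).mem hK)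
  have hn := norm_awayDir_le (g := g) hKb hxK hs.1.1 (hα.2.1 hv.1).1
  have hhalf := half_gap_le_awayDir (x := x) (g := g) (s := s) (v := v)
  have hG := hv.gap_nonneg hα hs
  set γ := awayStepSize L α x g s v
  set e := awayDir x g s v
  set D := Metric.diam K
  have hD : 0 ≤ D := Metric.diam_nonneg
  rw [add_sub_cancel_left, inner_smul_right, norm_smul, Real.norm_of_nonneg hγ0] at hdesc
  -- The error is relative to the pairwise gap, which is at most twice the progress rate `-gᵀ e`.
  -- The quadratic term takes another half of that rate, leaving the factor `1 / 2 - 2 D εg`.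
  have herr : inner ℝ (f' x - g) e ≤ 2 * D * εg * -(inner ℝ g e) := by
    calc inner ℝ (f' x - g) e ≤ ‖f' x - g‖ * ‖e‖ := real_inner_le_norm _ _
      _ ≤ (εg * inner ℝ g (v - s)) * D := by
        rw [norm_sub_rev]
        gcongr
      _ = 2 * D * εg * (inner ℝ g (v - s) / 2) := by ring
      _ ≤ 2 * D * εg * -(inner ℝ g e) := by gcongr
  rw [inner_sub_left] at herr
  have h1 := mul_le_mul_of_nonneg_left herr hγ0
  have h2 := mul_le_mul_of_nonneg_left hγr hγ0
  nlinarith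

/-- Under strong convexity, the squared pairwise gap of a good gradient estimate dominates the
optimality gap. -/
theorem IsObjective.gap_le_sq (hf : IsObjective K L μ f f') (hμ : 0 < μ) {c : ℝ}
    {z : EuclideanSpace ℝ (Fin d)} (hx : x ∈ K) (hz : z ∈ K)
    (hc : inner ℝ g (x - z) ≤ c * ‖x - z‖ * inner ℝ g (v - s))
    (hgood : ‖g - f' x‖ ≤ εg * inner ℝ g (v - s)) :
    2 * μ * (f x - f z) ≤ ((c + εg) * inner ℝ g (v - s)) ^ 2 := by
  have h1 := hf.stronglyConvex x hx z hz
  rw [← neg_sub x z, inner_neg_right] at h1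
  have h2 : inner ℝ (f' x - g) (x - z) ≤ εg * inner ℝ g (v - s) * ‖x - z‖ := by
    refine (real_inner_le_norm _ _).trans ?_
    rw [norm_sub_rev]
    gcongr
  rw [inner_sub_left] at h2
  -- Completing the square eliminates the unknown distance `‖x - z‖`.
  nlinarith [sq_nonneg ((c + εg) * inner ℝ g (v - s) - μ * ‖x - z‖)]

/-- The guaranteed relative progress of the away-step potential. -/
def awayRate (L D M κ η : ℝ) : ℝ :=
  min (κ * η / (4 * L * D ^ 2)) (κ * η / (2 * (1 + 2 * M * η))) / 2

/-- With a good gradient estimate, the optimality gap plus a multiple of the number of active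
vertices decreases. -/
theorem IsObjective.away_potential_le (hf : IsObjective K L μ f f') (hK : Convex ℝ K)
    (hKb : Bornology.IsBounded K) (hL : 0 < L) (hD : 0 < Metric.diam K) (hεg : 0 < εg)
    (hκ : 4 * Metric.diam K * εg < 1) (hε : 0 < ε) (hεM : ε < 2 * M) {η : ℝ} (hη : 0 < η)
    (hα : IsVertexRep K α x) (hs : IsLPVertex K g s) (hv : IsAwayVertex α g v)
    (hgood : ‖g - f' x‖ ≤ εg * inner ℝ g (v - s)) (hgap : η * ε ≤ inner ℝ g (v - s) ^ 2) {θ : ℝ}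
    (hθ : θ = awayRate L (Metric.diam K) M (1 / 2 - 2 * Metric.diam K * εg) η * ε) :
    f (x + awayStepSize L α x g s v • awayDir x g s v) +
        θ * (awayWeights L α x g s v).support.card ≤ f x + θ * α.support.card - θ := by
  have hγ0 := awayStepSize_nonneg hL hα hs hv
  have hhalf := half_gap_le_awayDir (x := x) (g := g) (s := s) (v := v)
  have hG := hv.gap_nonneg hα hs
  have hn := norm_awayDir_le (g := g) hKb (hα.mem hK) hs.1.1 (hα.2.1 hv.1).1
  have hstep := hf.away_step_le hK hKb hL hεg hα hs hv hgood
  set κ := 1 / 2 - 2 * Metric.diam K * εg with hκdef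
  have hκ0 : 0 < κ := by linarith
  set D := Metric.diam K
  set G : ℝ := inner ℝ g (v - s)
  have hM : 0 < M := by linarith
  have hθ0 : 0 < θ := by
    rw [hθ, awayRate]
    positivity
  -- The two entries of the minimum serve the uncapped step and the full normal step. The decrease
  -- has to be `2 θ`: one `θ` pays for a possible new vertex, one remains.
  have hθ1 : 2 * θ ≤ κ * (η * ε / (4 * L * D ^ 2)) := by
    have := mul_le_mul_of_nonneg_right
      (min_le_left (κ * η / (4 * L * D ^ 2)) (κ * η / (2 * (1 + 2 * M * η)))) hε.le
    rw [hθ, awayRate]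
    calc _ = min (κ * η / (4 * L * D ^ 2)) (κ * η / (2 * (1 + 2 * M * η))) * ε := by ring
      _ ≤ _ := this
      _ = _ := by ring
  have hθ2 : 2 * θ ≤ κ * (η * ε / (1 + 2 * M * η) / 2) := by
    have := mul_le_mul_of_nonneg_right
      (min_le_right (κ * η / (4 * L * D ^ 2)) (κ * η / (2 * (1 + 2 * M * η)))) hε.le
    rw [hθ, awayRate]
    calc _ = min (κ * η / (4 * L * D ^ 2)) (κ * η / (2 * (1 + 2 * M * η))) * ε := by ring
      _ ≤ _ := this
      _ = _ := by field_simp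
  have hGpos : 0 < G := by
    rcases hG.eq_or_lt with h | h
    · rw [← h] at hgap
      have := mul_pos hη hε
      norm_num at hgap
      linarith
    · exact h
  -- In a drop step `f` does not increase and the lost vertex alone contributes `θ`.
  by_cases hdrop : ¬ ChoosesFW x g s v ∧ awayStepSize L α x g s v = awayMaxStep α x g s v
  · have hcard : ((awayWeights L α x g s v).support.card : ℝ) + 1 ≤ α.support.card := by
      exact_mod_cast card_support_awayWeights_lt hK hα hs hv hdrop.1 hdrop.2
    have h1 : 0 ≤ κ * (awayStepSize L α x g s v * -(inner ℝ g (awayDir x g s v))) := by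
      have : 0 ≤ -(inner ℝ g (awayDir x g s v)) := by linarith
      positivity
    nlinarith
  · have hcard : ((awayWeights L α x g s v).support.card : ℝ) ≤ α.support.card + 1 := by
      exact_mod_cast card_support_awayWeights_le hv
    have hdec : 2 * θ ≤ κ * (awayStepSize L α x g s v * -(inner ℝ g (awayDir x g s v))) := by
      by_cases hmax : awayStepSize L α x g s v = awayMaxStep α x g s v
      · have hc : ChoosesFW x g s v := by
          by_contra hc
          exact hdrop ⟨hc, hmax⟩
        have h1 : awayStepSize L α x g s v = 1 := by rw [hmax, awayMaxStep, if_pos hc]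
        rw [h1, one_mul]
        refine hθ2.trans (mul_le_mul_of_nonneg_left (le_trans ?_ hhalf) hκ0.le)
        -- Since `ε < 2 M`, a bound linear in `ε` follows from `G² ≥ η ε` without a square root.
        have h2 : η * ε / (1 + 2 * M * η) ≤ G := by
          refine abs_le_of_sq_le_sq' ?_ hG |>.2
          refine le_trans ?_ hgap
          have h3 : 0 < η * ε := mul_pos hη hε
          have h4 : 0 < M * η := mul_pos hM hη
          rw [div_pow, div_le_iff₀ (by positivity)]
          have h5 : η * ε ≤ (1 + 2 * M * η) ^ 2 := by nlinarith
          nlinarith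
        linarith
      · have hγ : awayStepSize L α x g s v =
            -(inner ℝ g (awayDir x g s v)) / (L * ‖awayDir x g s v‖ ^ 2) := by
          rcases min_choice (awayMaxStep α x g s v)
            (-(inner ℝ g (awayDir x g s v)) / (L * ‖awayDir x g s v‖ ^ 2)) with h | h
          · exact absurd h hmax
          · exact h
        have hne : 0 < ‖awayDir x g s v‖ := norm_pos_iff.mpr fun h => by
          rw [h, inner_zero_right] at hhalf
          linarith
        refine hθ1.trans (mul_le_mul_of_nonneg_left ?_ hκ0.le)
        have hr : 0 ≤ -(inner ℝ g (awayDir x g s v)) := by linarith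
        rw [hγ, div_mul_eq_mul_div]
        calc η * ε / (4 * L * D ^ 2) ≤ G ^ 2 / (4 * L * D ^ 2) := by gcongr
          _ = (G / 2) * (G / 2) / (L * D ^ 2) := by ring
          _ ≤ _ := by
            gcongr
    have h1 := mul_le_mul_of_nonneg_left hcard hθ0.le
    linarith

theorem IsAwayPath.isVertexRep {x : ℕ → EuclideanSpace ℝ (Fin d)}
    {α : ℕ → EuclideanSpace ℝ (Fin d) →₀ ℝ} {g s v : ℕ → EuclideanSpace ℝ (Fin d)}
    (hK : Convex ℝ K) (hL : 0 < L) (h : IsAwayPath K f L ε x α g s v)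
    (h0 : IsVertexRep K (α 0) (x 0)) (k : ℕ) : IsVertexRep K (α k) (x k) := by
  induction k with
  | zero => exact h0
  | succ k ih =>
    by_cases hk : (k : ℕ∞) < hitTime K f ε x
    · rw [h.step k hk, h.weights k hk]
      exact ih.away_step hL hK (h.lp k hk) (h.away k hk)
    · rw [(h.frozen k (not_lt.mp hk)).1, (h.frozen k (not_lt.mp hk)).2]
      exact ih

/-- Expected number of iterations and moment generating function of away-step Frank-Wolfe. -/
theorem away_complexity {Ω : Type*} {m₀ : MeasurableSpace Ω} {P : Measure Ω}
    [IsProbabilityMeasure P] {ℱ : Filtration ℕ m₀} (hf : IsObjective K L μ f f')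
    (hK : Convex ℝ K) (hKc : IsCompact K) (hμ : 0 < μ) (hM : ∀ x ∈ K, |f x| ≤ M) (hε : 0 < ε)
    (hεg : 0 < εg) (hκ : 4 * Metric.diam K * εg < 1) {c : ℝ} (hc0 : 0 < c)
    (hc : ∀ (α : EuclideanSpace ℝ (Fin d) →₀ ℝ) (x y g s v : EuclideanSpace ℝ (Fin d)),
      IsVertexRep K α x → y ∈ K → IsLPVertex K g s →
      IsAwayVertex α g v → inner ℝ g (x - y) ≤ c * ‖x - y‖ * inner ℝ g (v - s))
    {x₀ : EuclideanSpace ℝ (Fin d)} {α₀ : EuclideanSpace ℝ (Fin d) →₀ ℝ}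
    {X : ℕ → Ω → EuclideanSpace ℝ (Fin d)} {α : ℕ → Ω → EuclideanSpace ℝ (Fin d) →₀ ℝ}
    {G S V : ℕ → Ω → EuclideanSpace ℝ (Fin d)}
    (hproc : IsAwayProcess ℱ K f L ε x₀ α₀ X α G S V) {θ : ℝ}
    (hθ : θ = awayRate L (Metric.diam K) M (1 / 2 - 2 * Metric.diam K * εg)
      (2 * μ / (c + εg) ^ 2) * ε) {N : ℕ} (hN : 2 * M / θ + 2 ≤ N)
    (hgood : GoodAway P ℱ K f f' ε εg (1 - (2 ^ (N + 1) : ℝ)⁻¹) X G S V)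
    (hgap : ε < f x₀ - optVal K f) :
    ∫⁻ ω, ((hitTime K f ε fun k => X k ω : ℕ∞) : ENNReal) ∂P ≤
        ENNReal.ofReal (2 * ((f x₀ - optVal K f + θ * α₀.support.card) / θ)) ∧
      (∀ᵐ ω ∂P, (hitTime K f ε fun k => X k ω) ≠ ⊤) ∧
      ∀ t : ℝ, |t| ≤ Real.log (5 / 4) → Integrable
        (fun ω => Real.exp (t * ((hitTime K f ε fun k => X k ω).toNat : ℝ))) P := by
  have hx₀ : x₀ ∈ K := hproc.rep_init.mem hK
  obtain ⟨hL, hD, hεM⟩ := hf.parameters_pos hKc hμ hM hε hx₀ hgap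
  obtain ⟨z, hz, hzf⟩ := hf.exists_minimizer hKc hM hx₀
  have hrep : ∀ k ω, IsVertexRep K (α k ω) (X k ω) := fun k ω =>
    (hproc.path ω).isVertexRep hK hL
      (by simpa only [hproc.init ω, hproc.weights_init ω] using hproc.rep_init) k
  have hXK : ∀ k ω, X k ω ∈ K := fun k ω => (hrep k ω).mem hK
  have hη : 0 < 2 * μ / (c + εg) ^ 2 := by positivity
  have hθ0 : 0 < θ := by
    have : 0 < 1 / 2 - 2 * Metric.diam K * εg := by linarith
    have : 0 < M := by linarith
    rw [hθ, awayRate]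
    positivity
  refine hitting_time_bounds (ℱ := ℱ) (K := N)
    (E := fun k => {ω | ‖G k ω - f' (X k ω)‖ ≤ εg * inner ℝ (G k ω) (V k ω - S k ω)})
    (measurableSet_lt_hitTime hf.continuousOn hproc.measurable_iterate hXK) (fun k => ?_) hgood
    fun ω n => ?_
  · have h1 : Measurable[ℱ (k + 1)] (X k) :=
      (hproc.measurable_iterate k).mono (ℱ.mono (Nat.le_succ k)) le_rfl
    have hVS := Measurable.sub (hproc.measurable_away k) (hproc.measurable_vertex k)
    exact hf.measurableSet_gradient_error_le h1 (hXK k) (hproc.measurable_gradient k)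
      (Measurable.const_mul (Measurable.inner (hproc.measurable_gradient k) hVS) εg)
  · have hpath := hproc.path ω
    have := stepCount_le_of_potential (T := fun ω => hitTime K f ε fun k => X k ω)
      (E := fun k => {ω | ‖G k ω - f' (X k ω)‖ ≤ εg * inner ℝ (G k ω) (V k ω - S k ω)}) (ω := ω)
      -- The weights enter only pathwise here, so their measurability is not needed.
      (Φ := fun k => f (X k ω) - optVal K f + θ * (α k ω).support.card) hθ0 (K := N)
      (fun k => add_nonneg (sub_nonneg.mpr (optVal_le hM (hXK k ω))) (by positivity))
      (fun k hk hE => ?_) (fun k hk => ?_)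
      (fun k hk => by rw [(hpath.frozen k hk).1, (hpath.frozen k hk).2]) n
    · simpa only [hproc.init ω, hproc.weights_init ω] using this
    · have hlt := lt_hitTime_iff.mp hk k le_rfl
      have hlp := hpath.lp k hk
      have haw := hpath.away k hk
      have hsq := hf.gap_le_sq hμ (hXK k ω) hz (hc _ _ _ _ _ _ (hrep k ω) hz hlp haw) hE
      have hηε : 2 * μ / (c + εg) ^ 2 * ε ≤ inner ℝ (G k ω) (V k ω - S k ω) ^ 2 := by
        rw [hzf, mul_pow] at hsq
        rw [div_mul_eq_mul_div, div_le_iff₀ (by positivity)]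
        nlinarith
      have := hf.away_potential_le hK hKc.isBounded hL hD hεg hκ hε hεM hη (hrep k ω) hlp haw hE
        hηε hθ
      rw [← hpath.step k hk, ← hpath.weights k hk] at this
      linarith
    · have h1 := sub_optVal_le hM (hXK (k + 1) ω)
      have h2 := optVal_le hM (hXK k ω)
      -- A bad step may raise the gap by `2 M` and also activate a vertex, at cost `θ`.
      have h3 : 2 * M + 2 * θ ≤ N * θ := by
        have := mul_le_mul_of_nonneg_right hN hθ0.le
        rwa [add_mul, div_mul_cancel₀ _ hθ0.ne'] at this
      have h4 : ((α (k + 1) ω).support.card : ℝ) ≤ (α k ω).support.card + 1 := by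
        rw [hpath.weights k hk]
        exact_mod_cast card_support_awayWeights_le (hpath.away k hk)
      have h5 := mul_le_mul_of_nonneg_left h4 hθ0.le
      linarith

end AwayStep

end StochFW

end

/-! ### Choice of the constants and the final theorem. -/

theorem mainTheorem1 {d m : ℕ} (A : Matrix (Fin m) (Fin d) ℝ) (b : Fin m → ℝ)
    (hbdd : Bornology.IsBounded (StochFW.polytope A b))
    (L μ M εg : ℝ) (hμ : 0 < μ) (hεg : 0 < εg)
    (hεgD : 4 * Metric.diam (StochFW.polytope A b) * εg < 1) :
    (∃ C : ℝ, 0 < C ∧ ∀ ε : ℝ, 0 < ε →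
      ∃ p : ℝ, 0 < p ∧ p < 1 ∧ ∃ δ : ℝ, 0 < δ ∧
        ∀ (f : EuclideanSpace ℝ (Fin d) → ℝ)
          (f' : EuclideanSpace ℝ (Fin d) → EuclideanSpace ℝ (Fin d)),
          StochFW.IsObjective (StochFW.polytope A b) L μ f f' →
          (∀ x ∈ StochFW.polytope A b, |f x| ≤ M) →
        ∀ (Ω : Type*) (m₀ : MeasurableSpace Ω) (P : Measure Ω) (_ : IsProbabilityMeasure P)
          (ℱ : Filtration ℕ m₀) (x₀ : EuclideanSpace ℝ (Fin d))
          (X G S : ℕ → Ω → EuclideanSpace ℝ (Fin d)),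
          StochFW.IsFWProcess ℱ (StochFW.polytope A b) f L ε x₀ X G S →
          StochFW.GoodFW P ℱ (StochFW.polytope A b) f f' ε p X G →
          ε < f x₀ - StochFW.optVal (StochFW.polytope A b) f →
          let T : Ω → ℕ∞ := fun ω => StochFW.hitTime (StochFW.polytope A b) f ε (fun k => X k ω)
          ∫⁻ ω, ((T ω : ℕ∞) : ENNReal) ∂P ≤ ENNReal.ofReal
              (C * (f x₀ - StochFW.optVal (StochFW.polytope A b) f) / ε ^ 2) ∧
            (∀ᵐ ω ∂P, T ω ≠ ⊤) ∧
            ∀ t : ℝ, |t| ≤ δ → Integrable (fun ω => Real.exp (t * ((T ω).toNat : ℝ))) P) ∧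
    (∃ C : ℝ, 0 < C ∧ ∀ ε : ℝ, 0 < ε →
      ∃ p : ℝ, 0 < p ∧ p < 1 ∧ ∃ δ : ℝ, 0 < δ ∧
        ∀ (f : EuclideanSpace ℝ (Fin d) → ℝ)
          (f' : EuclideanSpace ℝ (Fin d) → EuclideanSpace ℝ (Fin d)),
          StochFW.IsObjective (StochFW.polytope A b) L μ f f' →
          (∀ x ∈ StochFW.polytope A b, |f x| ≤ M) →
        ∀ (Ω : Type*) (m₀ : MeasurableSpace Ω) (P : Measure Ω) (_ : IsProbabilityMeasure P)
          (ℱ : Filtration ℕ m₀) (x₀ : EuclideanSpace ℝ (Fin d))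
          (α₀ : EuclideanSpace ℝ (Fin d) →₀ ℝ)
          (X : ℕ → Ω → EuclideanSpace ℝ (Fin d)) (α : ℕ → Ω → EuclideanSpace ℝ (Fin d) →₀ ℝ)
          (G S V : ℕ → Ω → EuclideanSpace ℝ (Fin d)),
          StochFW.IsAwayProcess ℱ (StochFW.polytope A b) f L ε x₀ α₀ X α G S V →
          StochFW.GoodAway P ℱ (StochFW.polytope A b) f f' ε εg p X G S V →
          ε < f x₀ - StochFW.optVal (StochFW.polytope A b) f →
          let T : Ω → ℕ∞ := fun ω => StochFW.hitTime (StochFW.polytope A b) f ε (fun k => X k ω)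
          ∫⁻ ω, ((T ω : ℕ∞) : ENNReal) ∂P ≤ ENNReal.ofReal
              (C * (f x₀ - StochFW.optVal (StochFW.polytope A b) f) / ε) ∧
            (∀ᵐ ω ∂P, T ω ≠ ⊤) ∧
            ∀ t : ℝ, |t| ≤ δ → Integrable (fun ω => Real.exp (t * ((T ω).toNat : ℝ))) P) := by
  set K := StochFW.polytope A b with hK
  have hKc : IsCompact K := StochFW.isCompact_polytope hbdd
  have hconv : Convex ℝ K := StochFW.convex_polytope
  have hp : ∀ N : ℕ, 0 < 1 - (2 ^ (N + 1) : ℝ)⁻¹ ∧ 1 - (2 ^ (N + 1) : ℝ)⁻¹ < 1 := fun N =>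
    ⟨sub_pos.mpr (inv_lt_one_of_one_lt₀ (one_lt_pow₀ one_lt_two N.succ_ne_zero)),
      sub_lt_self _ (by positivity)⟩
  have hlog : 0 < Real.log (5 / 4) := Real.log_pos (by norm_num)
  constructor
  -- The signs of `M` and `L` are known only once an admissible `f` and start exist; absolute values
  -- and `+ 1` make `C` positive beforehand.
  · refine ⟨4 * (2 * |M| + 2 * |L| * Metric.diam K ^ 2) + 1, by positivity, fun ε hε => ?_⟩
    set N := ⌈2 * M / (StochFW.fwStepSize K L ε * ε / 2) + 1⌉₊ with hN
    refine ⟨1 - (2 ^ (N + 1) : ℝ)⁻¹, (hp N).1, (hp N).2, Real.log (5 / 4), hlog, ?_⟩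
    intro f f' hf hM Ω m₀ P _ ℱ x₀ X G S hproc hgood hgap T
    obtain ⟨hL, hD, hεM⟩ := hf.parameters_pos hKc hμ hM hε hproc.mem_init hgap
    have hmain := StochFW.fw_complexity hf hconv hKc hμ hM hε hproc (Nat.le_ceil _) hgood hgap
    refine ⟨hmain.1.trans (ENNReal.ofReal_le_ofReal ?_), hmain.2⟩
    have hM0 : 0 < M := by linarith
    rw [abs_of_pos hM0, abs_of_pos hL]
    set D := Metric.diam K
    set h := f x₀ - StochFW.optVal K f
    set γ := StochFW.fwStepSize K L ε with hγ
    have hγ0 : 0 < γ := StochFW.fwStepSize_pos hL hD hε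
    have hh : 0 < h := hε.trans hgap
    -- The step size is at least of order `ε` in both branches of the minimum; the branch `γ = 1`
    -- uses `ε < 2 M`.
    have hγ1 : ε ≤ (2 * M + 2 * L * D ^ 2) * γ := by
      rcases min_choice 1 (ε / (2 * L * D ^ 2)) with h1 | h1
      · have : γ = 1 := h1
        rw [this]
        have : 0 < 2 * L * D ^ 2 := by positivity
        linarith
      · have : γ = ε / (2 * L * D ^ 2) := h1
        have h2 : ε = 2 * L * D ^ 2 * γ := by rw [this]; field_simp
        nlinarith [mul_pos hM0 hγ0]
    calc 2 * (h / (γ * ε / 2)) = 4 * h * ε / (γ * ε ^ 2) := by field_simp; norm_num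
      _ ≤ 4 * h * ((2 * M + 2 * L * D ^ 2) * γ) / (γ * ε ^ 2) := by gcongr
      _ = 4 * (2 * M + 2 * L * D ^ 2) * h / ε ^ 2 := by field_simp
      _ ≤ (4 * (2 * M + 2 * L * D ^ 2) + 1) * h / ε ^ 2 := by gcongr; linarith
  · obtain ⟨c, hc0, hc⟩ := StochFW.exists_pairwise_gap_constant hbdd
    set ρ := StochFW.awayRate L (Metric.diam K) M (1 / 2 - 2 * Metric.diam K * εg)
      (2 * μ / (c + εg) ^ 2) with hρ
    refine ⟨|2 / ρ| + 2 * (K.extremePoints ℝ).ncard + 1, by positivity, fun ε hε => ?_⟩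
    set N := ⌈2 * M / (ρ * ε) + 2⌉₊ with hN
    refine ⟨1 - (2 ^ (N + 1) : ℝ)⁻¹, (hp N).1, (hp N).2, Real.log (5 / 4), hlog, ?_⟩
    intro f f' hf hM Ω m₀ P _ ℱ x₀ α₀ X α G S V hproc hgood hgap T
    obtain ⟨hL, hD, hεM⟩ :=
      hf.parameters_pos hKc hμ hM hε (hproc.rep_init.mem hconv) hgap
    have hmain := StochFW.away_complexity hf hconv hKc hμ hM hε hεg hεgD hc0 hc hproc rfl
      (Nat.le_ceil _) hgood hgap
    refine ⟨hmain.1.trans (ENNReal.ofReal_le_ofReal ?_), hmain.2⟩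
    have hM0 : 0 < M := by linarith
    have hκ : 0 < 1 / 2 - 2 * Metric.diam K * εg := by linarith
    have hρ0 : 0 < ρ := by
      rw [hρ, StochFW.awayRate]
      positivity
    rw [← hρ, abs_of_pos (by positivity)]
    set h := f x₀ - StochFW.optVal K f
    have hcard : (α₀.support.card : ℝ) ≤ (K.extremePoints ℝ).ncard := by
      rw [← Set.ncard_coe_finset]
      exact_mod_cast Set.ncard_le_ncard hproc.rep_init.2.1 StochFW.finite_extremePoints_polytope
    -- The initial vertex count, at most the number of vertices of `K`, is absorbed because the
    -- initial gap exceeds `ε`.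
    have h1 : 1 ≤ h / ε := (one_le_div hε).mpr hgap.le
    calc 2 * ((h + ρ * ε * α₀.support.card) / (ρ * ε))
        = 2 / ρ * (h / ε) + 2 * α₀.support.card * 1 := by field_simp
      _ ≤ 2 / ρ * (h / ε) + 2 * (K.extremePoints ℝ).ncard * (h / ε) := by gcongr
      _ ≤ (2 / ρ + 2 * (K.extremePoints ℝ).ncard + 1) * h / ε := by
        rw [mul_div_assoc, add_mul, add_mul]
        linarith
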